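/- Let $m\ge 1$ and $d\ge 0$ be integers. Write points of $\mathbb{R}^{2m}$ as $\vec{x}=(\mathbf{x}_1,\dots,\mathbf{x}_m)$ with $\mathbf{x}_j=(x_j,y_j)\in\mathbb{R}^2$, and let $$Q_m(\vec{x})=\tfrac12\sum_{j=1}^m (x_j^2-y_j^2),\qquad B_m(\vec{x},\vec{x}')=\sum_{j=1}^m (x_jx_j'-y_jy_j').$$ Let $\mathcal{C}=\{\mathbf{x}=(x,y)\in\mathbb{R}^2 : Q_1(\mathbf{x})<0,\ y>0\}$ and $E(z)=2\int_0^z e^{-\pi u^2}\,du$. Let $f$ be a polynomial with complex coefficients in the variables $x_1,y_1,\dots,x_m,y_m$ that is spherical of degree $d$, that is, homogeneous of degree $d$ with $\sum_{j=1}^m\left(\frac{\partial^2}{\partial x_j^2}-\frac{\partial^2}{\partial y_j^2}\right)f=0$. For $\vec{c}_0=(\mathbf{c}_1^{(0)},\dots,\mathbf{c}_m^{(0)})$ and $\vec{c}_1=(\mathbf{c}_1^{(1)},\dots,\mathbf{c}_m^{(1)})$ in $\mathcal{C}^m$ define $$p^{\vec{c}_0,\vec{c}_1}[f](\vec{x})=\sum_{\sigma\in\{0,1\}^m}(-1)^{\sigma_1+\cdots+\sigma_m}\sum_{k=0}^d\frac{(-1)^k}{(4\pi)^k}\sum_{\substack{(k_1,\dots,k_m)\in(\mathbb{Z}_{\ge0})^m\\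 k_1+\cdots+k_m=k}}\left(\prod_{j=1}^m\frac{1}{k_j!}E^{(k_j)}\!\left(\frac{B_1(\mathbf{c}_j^{(\sigma_j)},\mathbf{x}_j)}{\sqrt{-Q_1(\mathbf{c}_j^{(\sigma_j)})}}\right)\right)\left(\prod_{j=1}^m\partial_{j,\mathbf{c}_j^{(\sigma_j)}}^{\,k_j}\right)f(\vec{x}),$$ where $\partial_{j,\mathbf{c}}=\frac{1}{\sqrt{-Q_1(\mathbf{c})}}\left(c_1\frac{\partial}{\partial x_j}+c_2\frac{\partial}{\partial y_j}\right)$ for $\mathbf{c}=(c_1,c_2)$, and $E^{(k)}$ is the $k$-th derivative of $E$. Then for all $\vec{a},\vec{b}\in\mathbb{R}^{2m}$ and all $\tau=u+iv\in\mathbb{C}$ with $v>0$, the series $$\theta_{\vec{a},\vec{b}}(\tau)=v^{-d/2}\sum_{\vec{x}\in\vec{a}+\mathbb{Z}^{2m}}p^{\vec{c}_0,\vec{c}_1}[f](\vec{x}\sqrt{v})\,e^{2\pi i\tau Q_m(\vec{x})}\,e^{2\pi iB_m(\vec{x},\vec{b})}$$ converges absolutely, and $$\theta_{\vec{a},\vec{b}}\left(-\frac1\tau\right)=(-\tau)^{m+d}\,e^{2\pi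 iB_m(\vec{a},\vec{b})}\,\theta_{-\vec{b},\vec{a}}(\tau).$$ -/

import Mathlib

open scoped BigOperators

noncomputable section

namespace IndefiniteTheta

/-- The quadratic form `Q₁(x, y) = (x² - y²) / 2` on `ℝ²`. -/
def Q₁ (x : Fin 2 → ℝ) : ℝ := (1 / 2) * (x 0 ^ 2 - x 1 ^ 2)

/-- The bilinear form associated with `Q₁`. -/
def B₁ (x y : Fin 2 → ℝ) : ℝ := x 0 * y 0 - x 1 * y 1

/-- The component `{Q₁ < 0, y > 0}` of the negative cone of `Q₁`. -/
def negCone : Set (Fin 2 → ℝ) := {c | Q₁ c < 0 ∧ 0 < c 1}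

/-- Points of `ℝ^{2m}`: the coordinate `(j, 0)` is `x_j` and the coordinate `(j, 1)` is `y_j`. -/
abbrev Vec (m : ℕ) : Type := Fin m × Fin 2 → ℝ

/-- Complex polynomials in the `2m` variables `x_j, y_j`. -/
abbrev Poly (m : ℕ) : Type := MvPolynomial (Fin m × Fin 2) ℂ

/-- The `j`-th plane component `(x_j, y_j)` of a point of `ℝ^{2m}`. -/
def Vec.comp {m : ℕ} (x : Vec m) (j : Fin m) : Fin 2 → ℝ := fun i => x (j, i)

/-- The quadratic form of signature `(m, m)`. -/
def Q {m : ℕ} (x : Vec m) : ℝ := (1 / 2) * ∑ j, (x (j, 0) ^ 2 - x (j, 1) ^ 2)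

/-- The bilinear form associated with `Q`. -/
def B {m : ℕ} (x y : Vec m) : ℝ := ∑ j, (x (j, 0) * y (j, 0) - x (j, 1) * y (j, 1))

/-- The Laplace operator of signature `(m, m)` on polynomials. -/
def laplace {m : ℕ} (f : Poly m) : Poly m :=
  ∑ j : Fin m, (MvPolynomial.pderiv (j, 0) (MvPolynomial.pderiv (j, 0) f)
    - MvPolynomial.pderiv (j, 1) (MvPolynomial.pderiv (j, 1) f))

/-- Spherical polynomials of degree `d`: homogeneous of degree `d` and annihilated by the
Laplace operator of signature `(m, m)`. -/
def IsSpherical {m : ℕ} (d : ℕ) (f : Poly m) : Prop :=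
  f.IsHomogeneous d ∧ laplace f = 0

/-- The error function `E(z) = 2 ∫₀ᶻ e^{-π u²} du`. -/
def E (z : ℝ) : ℝ := 2 * ∫ u in (0 : ℝ)..z, Real.exp (-Real.pi * u ^ 2)

/-- The operator `(-Q₁(c))^{-1/2} (c₁ ∂/∂x_j + c₂ ∂/∂y_j)` on polynomials. -/
def dirDeriv {m : ℕ} (c : Fin 2 → ℝ) (j : Fin m) : Module.End ℂ (Poly m) :=
  ((1 / √(-Q₁ c) : ℝ) : ℂ) •
    (((c 0 : ℝ) : ℂ) • (MvPolynomial.pderiv (j, (0 : Fin 2))).toLinearMap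
      + ((c 1 : ℝ) : ℂ) • (MvPolynomial.pderiv (j, (1 : Fin 2))).toLinearMap)

/-- The factor `F`, for the vectors `c j`, the orders `k j` and a point `x`. -/
def F {m : ℕ} (c : Fin m → Fin 2 → ℝ) (k : Fin m → ℕ) (x : Vec m) : ℝ :=
  ∏ j, (1 / ((k j).factorial : ℝ)) *
    iteratedDeriv (k j) E (B₁ (c j) (x.comp j) / √(-Q₁ (c j)))

/-- The factor `G`: apply all the operators `dirDeriv (c j) j ^ k j` (which commute) to `f` and
evaluate at `x`. -/
def G {m : ℕ} (f : Poly m) (c : Fin m → Fin 2 → ℝ) (k : Fin m → ℕ) (x : Vec m) : ℂ :=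
  MvPolynomial.eval (fun i => (x i : ℂ)) ((List.ofFn fun j => dirDeriv (c j) j ^ k j).prod f)

/-- The choice of `c_j^{(σ_j)}` for every `j`. -/
def select {m : ℕ} (c₀ c₁ : Fin m → Fin 2 → ℝ) (σ : Fin m → Fin 2) : Fin m → Fin 2 → ℝ :=
  fun j => if σ j = 0 then c₀ j else c₁ j

/-- The kernel `p^{c₀, c₁}[f]` for a polynomial `f` of degree `d`. The innermost sum runs over all
`κ ∈ (ℤ_{≥0})^m` with `κ_1 + ⋯ + κ_m = k`. -/
def kernel {m : ℕ} (c₀ c₁ : Fin m → Fin 2 → ℝ) (d : ℕ) (f : Poly m) (x : Vec m) : ℂ :=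
  ∑ σ : Fin m → Fin 2, (-1 : ℂ) ^ (∑ j, (σ j : ℕ)) *
    ∑ k ∈ Finset.range (d + 1), ((-1 : ℂ) ^ k / (4 * (Real.pi : ℂ)) ^ k) *
      ∑ κ ∈ Finset.piAntidiag (Finset.univ : Finset (Fin m)) k,
        (F (select c₀ c₁ σ) κ x : ℂ) * G f (select c₀ c₁ σ) κ x

/-- The term `p(x √v) q^{Q(x)} e^{2πi B(x, b)}` of the theta series, where `v = Im τ` and
`q^{Q(x)} = e^{2πi τ Q(x)}`. -/
def thetaTerm {m : ℕ} (c₀ c₁ : Fin m → Fin 2 → ℝ) (d : ℕ) (f : Poly m) (b : Vec m) (τ : ℂ)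
    (x : Vec m) : ℂ :=
  kernel c₀ c₁ d f (√τ.im • x)
    * Complex.exp (2 * (Real.pi : ℂ) * Complex.I * τ * (Q x : ℂ))
    * Complex.exp (2 * (Real.pi : ℂ) * Complex.I * (B x b : ℂ))

/-- The point `a + n` of the shifted lattice `a + ℤ^{2m}`. -/
def shift {m : ℕ} (a : Vec m) (n : Fin m × Fin 2 → ℤ) : Vec m := fun i => a i + (n i : ℝ)

/-- The theta function with characteristics `a, b`; the sum runs over `a + ℤ^{2m}`. -/
def theta {m : ℕ} (c₀ c₁ : Fin m → Fin 2 → ℝ) (d : ℕ) (f : Poly m) (a b : Vec m) (τ : ℂ) : ℂ :=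
  ((τ.im ^ (-(d : ℝ) / 2) : ℝ) : ℂ) *
    ∑' n : Fin m × Fin 2 → ℤ, thetaTerm c₀ c₁ d f b τ (shift a n)

end IndefiniteTheta

end

noncomputable section

namespace IndefiniteTheta

/-! ### Error function, Hermite operators in one plane, Taylor expansion along lines. -/

section ErrorFunction

open MvPolynomial

/-! ### Derivatives of the error function -/

/-! The theorem reduces to one plane, where the kernel is an integral of boosted Hermite functions
to which Poisson summation applies.

Reduction. Let `Δ` be the Laplace operator of signature `(m, m)`. A spherical `f` satisfies
`exp(-Δ/8π) f = f`. Applying `exp(-Δ/8π)` to the monomials of `f` writes `f` as a combination of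
products over the planes of the Hermite polynomials `exp(-Δ/8π)(x^i y^k)` (`eq_sum_planeProd`). On
such a product the kernel factors into one-plane differences (`kernel_eq_sum_prod`).

One plane. The cone, up to scaling, is parametrised by a hyperbolic angle `s`. With `X`, `Y` the
boosted coordinates, the `s`-derivative of the one-plane functional on `exp(-Δ/8π)(x^i y^k)` is a
constant times `cosh^i s · sinh^k s · H_{i+k+1}(X) e^{-2πY²}`, where `H_n` is `hermitePoly n`
(`hasDerivAt_coneOp_hermitePlane`). Multiplying by `q^{Q₁}` gives `boostFun`, a Hermite function in
`X` times a Gaussian in `Y`. It decays in all directions although `Q₁` is indefinite, which gives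
absolute convergence. Its Fourier transform for `B₁` is the same function at `-1/τ` times a phase
(`integral_boostFun`). Poisson summation then transforms its lattice sum
(`tsum_boostFun_neg_one_div`), and integration over `s` transforms the plane theta series
(`tsum_planeTerm_neg_one_div`).

Assembly. A plane with monomial `x^i y^k` contributes `|τ| (-τ/|τ|)^{i+k+1}`. Since `f` is
homogeneous of degree `d`, the product over the planes is `|τ|^m (-τ/|τ|)^{m+d}` for every monomial,
and `v^{-d/2}` supplies `|τ|^d`; together they give `(-τ)^{m+d}`. -/

lemma hasDerivAt_E (z : ℝ) : HasDerivAt E (2 * Real.exp (-Real.pi * z ^ 2)) z := by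
  have hc : Continuous fun u : ℝ => Real.exp (-Real.pi * u ^ 2) := by fun_prop
  exact ((hc.integral_hasStrictDerivAt 0 z).hasDerivAt).const_mul 2

lemma deriv_E : deriv E = fun z => 2 * Real.exp (-Real.pi * z ^ 2) :=
  funext fun z => (hasDerivAt_E z).deriv

lemma contDiff_E : ContDiff ℝ (⊤ : ℕ∞) E := by
  rw [contDiff_infty_iff_deriv, deriv_E]
  exact ⟨fun z => (hasDerivAt_E z).differentiableAt, by fun_prop⟩

lemma hasDerivAt_iteratedDeriv_E (k : ℕ) (z : ℝ) :
    HasDerivAt (iteratedDeriv k E) (iteratedDeriv (k + 1) E z) z := by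
  rw [iteratedDeriv_succ]
  exact (contDiff_E.differentiable_iteratedDeriv k
    (by exact_mod_cast ENat.natCast_lt_top k) z).hasDerivAt

/-- The differential equation satisfied by the derivatives of `E`. -/
lemma iteratedDeriv_E_add_two (k : ℕ) (z : ℝ) :
    iteratedDeriv (k + 2) E z =
      -2 * Real.pi * (z * iteratedDeriv (k + 1) E z + k * iteratedDeriv k E z) := by
  induction k generalizing z with
  | zero =>
    have h : iteratedDeriv 1 E = fun z => 2 * Real.exp (-Real.pi * z ^ 2) := by
      rw [iteratedDeriv_one, deriv_E]
    have h2 : HasDerivAt (iteratedDeriv 1 E)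
        (2 * (Real.exp (-Real.pi * z ^ 2) * (-Real.pi * (2 * z)))) z := by
      rw [h]
      have := (((hasDerivAt_pow 2 z).const_mul (-Real.pi)).exp).const_mul 2
      simpa using this
    rw [(hasDerivAt_iteratedDeriv_E 1 z).unique h2, zero_add, h]
    push_cast; ring
  | succ k ih =>
    have h1 := hasDerivAt_iteratedDeriv_E (k + 2) z
    have h2 : HasDerivAt (iteratedDeriv (k + 2) E)
        (-2 * Real.pi * ((1 * iteratedDeriv (k + 1) E z + z * iteratedDeriv (k + 2) E z)
          + k * iteratedDeriv (k + 1) E z)) z := by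
      refine HasDerivAt.congr_of_eventuallyEq ?_ (Filter.Eventually.of_forall ih)
      exact (((hasDerivAt_id' z).fun_mul (hasDerivAt_iteratedDeriv_E (k + 1) z)).fun_add
        ((hasDerivAt_iteratedDeriv_E k z).const_mul (k : ℝ))).const_mul _
    rw [show k + 1 + 2 = k + 2 + 1 by ring, h1.unique h2]
    push_cast; ring

/-! ### Creation operators -/

section Creation

variable {σ : Type*}

/-- The operator `g ↦ X_i g - (ε_i / 4π) ∂_i g`. -/
def create (ε : σ → ℂ) (i : σ) : Module.End ℂ (MvPolynomial σ ℂ) :=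
  LinearMap.mulLeft ℂ (X i) - (ε i / (4 * (Real.pi : ℂ))) • (pderiv i).toLinearMap

lemma create_apply (ε : σ → ℂ) (i : σ) (g : MvPolynomial σ ℂ) :
    create ε i g = X i * g - C (ε i / (4 * (Real.pi : ℂ))) * pderiv i g := by
  simp [create, smul_eq_C_mul]

/-- The commutator of two derivations is again a derivation, so its vanishing need only be checked
on the variables. -/
lemma pderiv_comm (i j : σ) (g : MvPolynomial σ ℂ) :
    pderiv i (pderiv j g) = pderiv j (pderiv i g) := by
  classical
  have h : ⁅(pderiv i : Derivation ℂ (MvPolynomial σ ℂ) (MvPolynomial σ ℂ)),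
      (pderiv j : Derivation ℂ (MvPolynomial σ ℂ) (MvPolynomial σ ℂ))⁆ = 0 := by
    refine MvPolynomial.derivation_ext fun k => ?_
    rw [Derivation.commutator_apply, pderiv_X, pderiv_X]
    by_cases h1 : j = k <;> by_cases h2 : i = k <;> simp [h1, h2]
  have := congrArg (fun D => D g) h
  rw [Derivation.commutator_apply] at this
  exact sub_eq_zero.mp this

lemma create_comm (ε : σ → ℂ) (i j : σ) : Commute (create ε i) (create ε j) := by
  classical
  refine LinearMap.ext fun g => ?_
  rcases eq_or_ne i j with rfl | hij
  · rfl
  simp only [Module.End.mul_apply, create_apply, map_sub, Derivation.leibniz, pderiv_X, pderiv_C,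
    smul_eq_mul, Pi.single_apply, if_neg hij, if_neg hij.symm]
  rw [pderiv_comm i j g]
  ring

end Creation

/-- The signs of the form `x² - y²`. -/
def sgn (i : Fin 2) : ℂ := if i = 0 then 1 else -1

/-- The polynomial `exp(-Δ/8π) (x^i y^k)`. -/
def hermitePlane (i k : ℕ) : MvPolynomial (Fin 2) ℂ := (create sgn 0 ^ i) ((create sgn 1 ^ k) 1)

/-- The Hermite polynomials `exp(-∂²/8π) u^n`. -/
def hermitePoly : ℕ → Polynomial ℂ
  | 0 => 1
  | n + 1 => Polynomial.X * hermitePoly n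
      - Polynomial.C (1 / (4 * (Real.pi : ℂ))) * Polynomial.derivative (hermitePoly n)

/-! ### Restriction of a polynomial to a line -/

/-- The functional on `ℂ[w]` with values `e k` on `w ^ k`. -/
def coeffFunctional (e : ℕ → ℂ) : Polynomial ℂ →ₗ[ℂ] ℂ :=
  (Polynomial.basisMonomials ℂ).constr ℂ e

lemma coeffFunctional_monomial (e : ℕ → ℂ) (k : ℕ) (a : ℂ) :
    coeffFunctional e (Polynomial.monomial k a) = a * e k := by
  have h : Polynomial.monomial k a = a • Polynomial.basisMonomials ℂ k := by
    simp [Polynomial.smul_monomial]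
  rw [h, map_smul, coeffFunctional, Module.Basis.constr_basis, smul_eq_mul]

lemma coeffFunctional_C (e : ℕ → ℂ) (a : ℂ) : coeffFunctional e (Polynomial.C a) = a * e 0 :=
  coeffFunctional_monomial e 0 a

lemma coeffFunctional_C_mul (e : ℕ → ℂ) (a : ℂ) (p : Polynomial ℂ) :
    coeffFunctional e (Polynomial.C a * p) = a * coeffFunctional e p := by
  rw [← Polynomial.smul_eq_C_mul, map_smul, smul_eq_mul]

lemma coeffFunctional_X_mul (e : ℕ → ℂ) (p : Polynomial ℂ) :
    coeffFunctional e (Polynomial.X * p) = coeffFunctional (fun k => e (k + 1)) p := by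
  induction p using Polynomial.induction_on' with
  | add p q hp hq => rw [mul_add, map_add, map_add, hp, hq]
  | monomial n a =>
    rw [Polynomial.X_mul_monomial, coeffFunctional_monomial, coeffFunctional_monomial]

lemma coeffFunctional_smul (c : ℂ) (e : ℕ → ℂ) (p : Polynomial ℂ) :
    coeffFunctional (fun k => c * e k) p = c * coeffFunctional e p := by
  induction p using Polynomial.induction_on' with
  | add p q hp hq => rw [map_add, map_add, hp, hq, mul_add]
  | monomial n a => rw [coeffFunctional_monomial, coeffFunctional_monomial]; ring

lemma coeffFunctional_eq_sum (e : ℕ → ℂ) (p : Polynomial ℂ) {N : ℕ} (hN : p.natDegree < N) :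
    coeffFunctional e p = ∑ k ∈ Finset.range N, p.coeff k * e k := by
  conv_lhs => rw [p.as_sum_range' N hN]
  rw [map_sum]
  exact Finset.sum_congr rfl fun k _ => coeffFunctional_monomial _ _ _

/-- The polynomial `w ↦ g (x + w u)`. -/
def lineRestrict (x u : Fin 2 → ℝ) : MvPolynomial (Fin 2) ℂ →ₐ[ℂ] Polynomial ℂ :=
  aeval fun i => Polynomial.C (x i : ℂ) + Polynomial.C (u i : ℂ) * Polynomial.X

lemma lineRestrict_X (x u : Fin 2 → ℝ) (i : Fin 2) :
    lineRestrict x u (X i) = Polynomial.C (x i : ℂ) + Polynomial.C (u i : ℂ) * Polynomial.X :=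
  aeval_X _ _

lemma lineRestrict_C (x u : Fin 2 → ℝ) (a : ℂ) :
    lineRestrict x u (C a) = Polynomial.C a :=
  aeval_C _ _

/-- The derivative in the direction `u`. -/
def planeDeriv (u : Fin 2 → ℝ) : Module.End ℂ (MvPolynomial (Fin 2) ℂ) :=
  (u 0 : ℂ) • (pderiv 0).toLinearMap + (u 1 : ℂ) • (pderiv 1).toLinearMap

lemma planeDeriv_apply (u : Fin 2 → ℝ) (g : MvPolynomial (Fin 2) ℂ) :
    planeDeriv u g = C (u 0 : ℂ) * pderiv 0 g + C (u 1 : ℂ) * pderiv 1 g := by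
  simp [planeDeriv, smul_eq_C_mul]

lemma lineRestrict_planeDeriv (x u : Fin 2 → ℝ) (g : MvPolynomial (Fin 2) ℂ) :
    lineRestrict x u (planeDeriv u g) = Polynomial.derivative (lineRestrict x u g) := by
  induction g using MvPolynomial.induction_on with
  | C a => simp [planeDeriv_apply]
  | add p q hp hq => rw [map_add, map_add, hp, hq, map_add, map_add]
  | mul_X p i hp =>
    have h : planeDeriv u (p * X i) = planeDeriv u p * X i + C (u i : ℂ) * p := by
      fin_cases i <;>
        simp [planeDeriv_apply, Derivation.leibniz, pderiv_X] <;> ring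
    rw [h, map_add, map_mul, map_mul, hp, map_mul, Polynomial.derivative_mul, lineRestrict_X,
      lineRestrict_C]
    simp; ring

lemma lineRestrict_planeDeriv_pow (x u : Fin 2 → ℝ) (k : ℕ) (g : MvPolynomial (Fin 2) ℂ) :
    lineRestrict x u ((planeDeriv u ^ k) g) =
      Polynomial.derivative^[k] (lineRestrict x u g) := by
  induction k with
  | zero => rfl
  | succ k ih =>
    rw [pow_succ', Module.End.mul_apply, lineRestrict_planeDeriv, ih, Function.iterate_succ_apply']

lemma coeff_zero_lineRestrict (x u : Fin 2 → ℝ) (g : MvPolynomial (Fin 2) ℂ) :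
    (lineRestrict x u g).coeff 0 = eval (fun i => (x i : ℂ)) g := by
  induction g using MvPolynomial.induction_on with
  | C a => simp
  | add p q hp hq => rw [map_add, Polynomial.coeff_add, hp, hq, map_add]
  | mul_X p i hp => rw [map_mul, Polynomial.mul_coeff_zero, hp, map_mul, lineRestrict_X]; simp

/-- Taylor's formula. It absorbs the `1/k!` of the kernel and turns the sum over `k` into a
functional of the coefficients of `lineRestrict`. -/
lemma eval_planeDeriv_pow (x u : Fin 2 → ℝ) (k : ℕ) (g : MvPolynomial (Fin 2) ℂ) :
    eval (fun i => (x i : ℂ)) ((planeDeriv u ^ k) g) =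
      k.factorial * (lineRestrict x u g).coeff k := by
  rw [← coeff_zero_lineRestrict x u, lineRestrict_planeDeriv_pow,
    Polynomial.coeff_iterate_derivative]
  simp [Nat.descFactorial_self]

lemma natDegree_lineRestrict_le (x u : Fin 2 → ℝ) (g : MvPolynomial (Fin 2) ℂ) :
    (lineRestrict x u g).natDegree ≤ g.totalDegree := by
  rw [lineRestrict, aeval_def, eval₂_eq]
  refine Polynomial.natDegree_sum_le_of_forall_le _ _ fun s hs => ?_
  refine (Polynomial.natDegree_C_mul_le _ _).trans ((Polynomial.natDegree_prod_le _ _).trans ?_)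
  refine le_trans (Finset.sum_le_sum fun i _ => ?_) (le_totalDegree hs)
  refine Polynomial.natDegree_pow_le.trans ?_
  have : (Polynomial.C (x i : ℂ) + Polynomial.C (u i : ℂ) * Polynomial.X).natDegree ≤ 1 := by
    compute_degree
  nlinarith

end ErrorFunction

/-! ### Derivative of the one-plane kernel in the hyperbolic angle. -/

section ConeOperators

open MvPolynomial

/-! ### The one-plane operators attached to a point of the negative cone -/

/-- The first boosted coordinate. -/
def boostX (t : ℝ) (x : Fin 2 → ℝ) : ℝ := x 0 * Real.cosh t - x 1 * Real.sinh t

/-- The second boosted coordinate. -/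
def boostY (t : ℝ) (x : Fin 2 → ℝ) : ℝ := x 1 * Real.cosh t - x 0 * Real.sinh t

/-- The vector of norm `Q₁ = -1` in the negative cone with hyperbolic angle `t`. -/
def coneVec (t : ℝ) : Fin 2 → ℝ := fun i => √2 * if i = 0 then Real.sinh t else Real.cosh t

/-- The functional
`g ↦ ∑ k, (-1/4π)^k / k! * E^{(k + r)}(B₁(c, x)) (∂_c^k g)(x)` for `c = coneVec t`. -/
def coneOp (r : ℕ) (t : ℝ) (x : Fin 2 → ℝ) : MvPolynomial (Fin 2) ℂ →ₗ[ℂ] ℂ :=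
  coeffFunctional (fun k => (-1 / (4 * (Real.pi : ℂ))) ^ k *
      ((iteratedDeriv (k + r) E (-(√2 * boostY t x)) : ℝ) : ℂ)) ∘ₗ
    (lineRestrict x (coneVec t)).toLinearMap

lemma coneOp_apply (r : ℕ) (t : ℝ) (x : Fin 2 → ℝ) (g : MvPolynomial (Fin 2) ℂ) :
    coneOp r t x g = coeffFunctional (fun k => (-1 / (4 * (Real.pi : ℂ))) ^ k *
      ((iteratedDeriv (k + r) E (-(√2 * boostY t x)) : ℝ) : ℂ)) (lineRestrict x (coneVec t) g) := rfl

lemma coneOp_C (r : ℕ) (t : ℝ) (x : Fin 2 → ℝ) (a : ℂ) :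
    coneOp r t x (C a) = a * ((iteratedDeriv r E (-(√2 * boostY t x)) : ℝ) : ℂ) := by
  rw [coneOp_apply, lineRestrict_C, coeffFunctional_C]
  simp

lemma coneOp_C_mul (r : ℕ) (t : ℝ) (x : Fin 2 → ℝ) (a : ℂ) (g : MvPolynomial (Fin 2) ℂ) :
    coneOp r t x (C a * g) = a * coneOp r t x g := by
  rw [← smul_eq_C_mul, map_smul, smul_eq_mul]

/-- On the line, `X i` becomes `x i + coneVec t i * w`. Multiplication by `w` shifts the
coefficients by one, which costs a factor `-1/4π` and raises the order of the derivative of `E`. -/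
lemma coneOp_X_mul (r : ℕ) (t : ℝ) (x : Fin 2 → ℝ) (i : Fin 2) (g : MvPolynomial (Fin 2) ℂ) :
    coneOp r t x (X i * g) =
      x i * coneOp r t x g - coneVec t i / (4 * (Real.pi : ℂ)) * coneOp (r + 1) t x g := by
  rw [coneOp_apply, map_mul, lineRestrict_X, add_mul, map_add, coeffFunctional_C_mul, mul_assoc,
    coeffFunctional_C_mul, coeffFunctional_X_mul, coneOp_apply, coneOp_apply]
  have : (fun k : ℕ => (-1 / (4 * (Real.pi : ℂ))) ^ (k + 1) *
      ((iteratedDeriv (k + 1 + r) E (-(√2 * boostY t x)) : ℝ) : ℂ)) =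
      fun k => (-1 / (4 * (Real.pi : ℂ))) * ((-1 / (4 * (Real.pi : ℂ))) ^ k *
        ((iteratedDeriv (k + (r + 1)) E (-(√2 * boostY t x)) : ℝ) : ℂ)) := by
    ext k
    rw [show k + 1 + r = k + (r + 1) by ring]; ring
  rw [this, coeffFunctional_smul]
  ring

/-- The creation operator of the first boosted coordinate. -/
def createX (t : ℝ) : Module.End ℂ (MvPolynomial (Fin 2) ℂ) :=
  (Real.cosh t : ℂ) • create sgn 0 - (Real.sinh t : ℂ) • create sgn 1

/-- The creation operator of the second boosted coordinate. -/
def createY (t : ℝ) : Module.End ℂ (MvPolynomial (Fin 2) ℂ) :=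
  (Real.cosh t : ℂ) • create sgn 1 - (Real.sinh t : ℂ) • create sgn 0

lemma cosh_sq_sub_sinh_sq_ofReal (t : ℝ) :
    (Real.cosh t : ℂ) ^ 2 - (Real.sinh t : ℂ) ^ 2 = 1 := by
  exact_mod_cast Real.cosh_sq_sub_sinh_sq t

/-- Inverse boost: `createX` and `createY` are the hyperbolic rotation of the two creation
operators. -/
lemma create_zero_eq (t : ℝ) :
    create sgn 0 = (Real.cosh t : ℂ) • createX t + (Real.sinh t : ℂ) • createY t := by
  have h := cosh_sq_sub_sinh_sq_ofReal t
  have e : (Real.cosh t : ℂ) • createX t + (Real.sinh t : ℂ) • createY t =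
      ((Real.cosh t : ℂ) ^ 2 - (Real.sinh t : ℂ) ^ 2) • create sgn 0 := by
    rw [createX, createY]; module
  rw [e, h, one_smul]

lemma create_one_eq (t : ℝ) :
    create sgn 1 = (Real.sinh t : ℂ) • createX t + (Real.cosh t : ℂ) • createY t := by
  have h := cosh_sq_sub_sinh_sq_ofReal t
  have e : (Real.sinh t : ℂ) • createX t + (Real.cosh t : ℂ) • createY t =
      ((Real.cosh t : ℂ) ^ 2 - (Real.sinh t : ℂ) ^ 2) • create sgn 1 := by
    rw [createX, createY]; module
  rw [e, h, one_smul]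

lemma createX_comm (t : ℝ) (i : Fin 2) : Commute (createX t) (create sgn i) :=
  ((create_comm sgn 0 i).smul_left _).sub_left ((create_comm sgn 1 i).smul_left _)

lemma createX_apply (t : ℝ) (g : MvPolynomial (Fin 2) ℂ) :
    createX t g = C (Real.cosh t : ℂ) * (X 0 * g - C (1 / (4 * (Real.pi : ℂ))) * pderiv 0 g)
      - C (Real.sinh t : ℂ) * (X 1 * g + C (1 / (4 * (Real.pi : ℂ))) * pderiv 1 g) := by
  simp [createX, create_apply, sgn, smul_eq_C_mul, neg_div]
  ring

lemma createY_apply (t : ℝ) (g : MvPolynomial (Fin 2) ℂ) :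
    createY t g = C (Real.cosh t : ℂ) * (X 1 * g + C (1 / (4 * (Real.pi : ℂ))) * pderiv 1 g)
      - C (Real.sinh t : ℂ) * (X 0 * g - C (1 / (4 * (Real.pi : ℂ))) * pderiv 0 g) := by
  simp [createY, create_apply, sgn, smul_eq_C_mul, neg_div]
  ring

lemma createX_C (t : ℝ) (a : ℂ) :
    createX t (C a) = C (Real.cosh t : ℂ) * (X 0 * C a) - C (Real.sinh t : ℂ) * (X 1 * C a) := by
  rw [createX_apply]; simp

/-- The scalar commutator is, up to `-√2 * 4π`, the `t`-derivative of `coneVec t i`. This match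
makes the induction in `hasDerivAt_coneOp` close. -/
lemma createX_mul_X (t : ℝ) (g : MvPolynomial (Fin 2) ℂ) (i : Fin 2) :
    createX t (g * X i) = X i * createX t g
      - C ((if i = 0 then Real.cosh t else Real.sinh t : ℝ) / (4 * (Real.pi : ℂ))) * g := by
  rw [createX_apply, createX_apply]
  fin_cases i <;> simp [Derivation.leibniz, pderiv_X, div_eq_mul_inv] <;> ring

lemma ofReal_sqrt_two_sq : ((√2 : ℝ) : ℂ) ^ 2 = 2 := by
  rw [← Complex.ofReal_pow, Real.sq_sqrt (by norm_num)]; norm_num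

lemma hasDerivAt_boostY (t : ℝ) (x : Fin 2 → ℝ) :
    HasDerivAt (fun t => boostY t x) (-boostX t x) t := by
  have := ((Real.hasDerivAt_cosh t).const_mul (x 1)).sub ((Real.hasDerivAt_sinh t).const_mul (x 0))
  convert! this using 1
  rw [boostX]; ring

lemma hasDerivAt_coneVec (t : ℝ) (i : Fin 2) : HasDerivAt (fun t => coneVec t i)
    (√2 * if i = 0 then Real.cosh t else Real.sinh t) t := by
  fin_cases i
  · simpa [coneVec] using (Real.hasDerivAt_sinh t).const_mul √2
  · simpa [coneVec] using (Real.hasDerivAt_cosh t).const_mul √2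

/-- On constants, `-√2 boostY` has derivative `√2 boostX`, and `createX` multiplies by the
corresponding linear form. Multiplication by a variable is handled by `coneOp_X_mul` and the product
rule: the derivative of `coneVec` is the commutator of `createX` with the variable. -/
lemma hasDerivAt_coneOp (r : ℕ) (t : ℝ) (x : Fin 2 → ℝ) (g : MvPolynomial (Fin 2) ℂ) :
    HasDerivAt (fun t => coneOp r t x g) (√2 * coneOp (r + 1) t x (createX t g)) t := by
  induction g using MvPolynomial.induction_on generalizing r with
  | C a =>
    have h1 : HasDerivAt (fun t => iteratedDeriv r E (-(√2 * boostY t x)))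
        (iteratedDeriv (r + 1) E (-(√2 * boostY t x)) * (-(√2 * -boostX t x))) t :=
      (hasDerivAt_iteratedDeriv_E r _).comp t (((hasDerivAt_boostY t x).const_mul √2).neg)
    have h2 := (h1.ofReal_comp).const_mul a
    simp only [coneOp_C]
    refine h2.congr_deriv ?_
    rw [createX_C, map_sub, coneOp_C_mul, coneOp_C_mul, coneOp_X_mul, coneOp_X_mul, coneOp_C,
      coneOp_C, boostX]
    simp [coneVec]
    ring
  | add p q hp hq =>
    simp only [map_add, mul_add]
    exact (hp r).add (hq r)
  | mul_X p i hp =>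
    have e : (fun t => coneOp r t x (p * X i)) = fun t => (x i : ℂ) * coneOp r t x p -
        (coneVec t i : ℂ) / (4 * (Real.pi : ℂ)) * coneOp (r + 1) t x p := by
      ext s
      rw [mul_comm, coneOp_X_mul]
    rw [e]
    have h1 := ((hp r).const_mul (x i : ℂ)).sub
      ((((hasDerivAt_coneVec t i).ofReal_comp).div_const (4 * (Real.pi : ℂ))).mul (hp (r + 1)))
    refine h1.congr_deriv ?_
    rw [createX_mul_X, map_sub, coneOp_C_mul, coneOp_X_mul]
    push_cast
    ring

/-- Restricted to the line in direction `coneVec t`, `createY` becomes `(Y + √2 w) + (4π√2)⁻¹ d/dw`.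
Applied to `w^k`, the claim is exactly the differential equation `iteratedDeriv_E_add_two` at `z =
-√2 Y`. -/
lemma coneOp_one_createY (t : ℝ) (x : Fin 2 → ℝ) (g : MvPolynomial (Fin 2) ℂ) :
    coneOp 1 t x (createY t g) = 0 := by
  have h2 := ofReal_sqrt_two_sq
  have hs : ((√2 : ℝ) : ℂ) ≠ 0 := by
    intro h; rw [h] at h2; norm_num at h2
  have hpi : (Real.pi : ℂ) ≠ 0 := by exact_mod_cast Real.pi_ne_zero
  have hcs := cosh_sq_sub_sinh_sq_ofReal t
  have e : lineRestrict x (coneVec t) (createY t g) =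
      (Polynomial.C (boostY t x : ℂ) + Polynomial.C ((√2 : ℝ) : ℂ) * Polynomial.X) *
        lineRestrict x (coneVec t) g + Polynomial.C (1 / (4 * (Real.pi : ℂ) * (√2 : ℝ))) *
          Polynomial.derivative (lineRestrict x (coneVec t) g) := by
    have e1 : createY t g = (C (Real.cosh t : ℂ) * X 1 - C (Real.sinh t : ℂ) * X 0) * g +
        C (1 / (4 * (Real.pi : ℂ) * (√2 : ℝ))) * planeDeriv (coneVec t) g := by
      have k1 : (1 / (4 * (Real.pi : ℂ))) =
          (1 / (4 * (Real.pi : ℂ) * (√2 : ℝ))) * ((√2 : ℝ) : ℂ) := by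
        field_simp
      rw [createY_apply, planeDeriv_apply, k1, C_mul]
      simp only [coneVec, if_true, one_ne_zero, if_false, Complex.ofReal_mul, C_mul]
      ring
    rw [e1, map_add, map_mul, map_mul, lineRestrict_planeDeriv, map_sub, map_mul, map_mul,
      lineRestrict_X, lineRestrict_X, lineRestrict_C, lineRestrict_C, lineRestrict_C]
    congr 2
    have hc : Polynomial.C (Real.cosh t : ℂ) ^ 2 - Polynomial.C (Real.sinh t : ℂ) ^ 2 = 1 := by
      rw [← Polynomial.C_pow, ← Polynomial.C_pow, ← Polynomial.C_sub, hcs, Polynomial.C_1]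
    simp only [coneVec, boostY, if_true, one_ne_zero, if_false, Complex.ofReal_mul,
      Complex.ofReal_sub, Polynomial.C_mul, Polynomial.C_sub]
    linear_combination (Polynomial.C ((√2 : ℝ) : ℂ) * Polynomial.X) * hc
  rw [coneOp_apply, e]
  generalize lineRestrict x (coneVec t) g = p
  induction p using Polynomial.induction_on' with
  | add p q hp hq =>
    rw [Polynomial.derivative_add, mul_add, mul_add, add_add_add_comm, map_add, hp, hq, add_zero]
  | monomial k a =>
    rw [add_mul, map_add, map_add, mul_assoc, coeffFunctional_C_mul, coeffFunctional_C_mul,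
      Polynomial.X_mul_monomial, coeffFunctional_C_mul, Polynomial.derivative_monomial,
      coeffFunctional_monomial, coeffFunctional_monomial, coeffFunctional_monomial]
    have ode : ((iteratedDeriv (k + 2) E (-(√2 * boostY t x)) : ℝ) : ℂ) =
        -2 * Real.pi * (-(√2 * boostY t x) *
            ((iteratedDeriv (k + 1) E (-(√2 * boostY t x)) : ℝ) : ℂ)
          + k * ((iteratedDeriv k E (-(√2 * boostY t x)) : ℝ) : ℂ)) := by
      exact_mod_cast iteratedDeriv_E_add_two k (-(√2 * boostY t x))
    rw [show k + 1 + 1 = k + 2 from rfl, ode]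
    -- The derivative term carries the truncated exponent `k - 1`; at `k = 0` its coefficient
    -- vanishes.
    rcases k with _ | k
    · simp
      field_simp
      linear_combination ((deriv E (-(√2 * boostY t x)) : ℝ) : ℂ) * a * boostY t x * (-2) * h2
    · rw [show k + 1 - 1 + 1 = k + 1 by omega, show k + 1 - 1 = k by omega]
      have h4 : (-1 / (4 * (Real.pi : ℂ))) ^ k =
          (-4 * Real.pi) * (-1 / (4 * (Real.pi : ℂ))) ^ (k + 1) := by
        rw [pow_succ]; field_simp
      rw [h4, pow_succ _ (k + 1)]
      generalize (-1 / (4 * (Real.pi : ℂ))) ^ (k + 1) = c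
      push_cast
      field_simp
      linear_combination (2 * a * c * (k + 1) *
          ((iteratedDeriv (k + 1) E (-(√2 * boostY t x)) : ℝ) : ℂ)
        - 2 * a * c * ((√2 : ℝ) : ℂ) * boostY t x *
          ((iteratedDeriv (k + 1 + 1) E (-(√2 * boostY t x)) : ℝ) : ℂ)) * h2

lemma coneOp_one_create_zero (t : ℝ) (x : Fin 2 → ℝ) (g : MvPolynomial (Fin 2) ℂ) :
    coneOp 1 t x (create sgn 0 g) = Real.cosh t * coneOp 1 t x (createX t g) := by
  rw [create_zero_eq t, LinearMap.add_apply, map_add, LinearMap.smul_apply, LinearMap.smul_apply,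
    map_smul, map_smul, coneOp_one_createY, smul_zero, add_zero, smul_eq_mul]

lemma coneOp_one_create_one (t : ℝ) (x : Fin 2 → ℝ) (g : MvPolynomial (Fin 2) ℂ) :
    coneOp 1 t x (create sgn 1 g) = Real.sinh t * coneOp 1 t x (createX t g) := by
  rw [create_one_eq t, LinearMap.add_apply, map_add, LinearMap.smul_apply, LinearMap.smul_apply,
    map_smul, map_smul, coneOp_one_createY, smul_zero, add_zero, smul_eq_mul]

/-- The hypothesis only replaces the outermost operator; commuting `createX` past the remaining ones
exposes the next. -/
lemma coneOp_one_create_pow (t : ℝ) (x : Fin 2 → ℝ) (i : Fin 2) (u : ℂ)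
    (h : ∀ g, coneOp 1 t x (create sgn i g) = u * coneOp 1 t x (createX t g))
    (n : ℕ) (g : MvPolynomial (Fin 2) ℂ) :
    coneOp 1 t x ((create sgn i ^ n) g) = u ^ n * coneOp 1 t x ((createX t ^ n) g) := by
  induction n generalizing g with
  | zero => simp
  | succ n ih =>
    have hc : createX t ((create sgn i ^ n) g) = (create sgn i ^ n) (createX t g) :=
      LinearMap.congr_fun ((createX_comm t i).pow_right n) g
    rw [pow_succ', Module.End.mul_apply, h, hc, ih, pow_succ (createX t), Module.End.mul_apply]
    ring

/-- On polynomials in the boosted linear form alone, `createX` acts as the one-variable Hermite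
recursion, because `cosh² - sinh² = 1`. -/
lemma createX_aeval (t : ℝ) (q : Polynomial ℂ) :
    createX t (Polynomial.aeval (C (Real.cosh t : ℂ) * X 0 - C (Real.sinh t : ℂ) * X 1) q) =
      Polynomial.aeval (C (Real.cosh t : ℂ) * X 0 - C (Real.sinh t : ℂ) * X 1)
        (Polynomial.X * q - Polynomial.C (1 / (4 * (Real.pi : ℂ))) * Polynomial.derivative q) := by
  have hc : C (Real.cosh t : ℂ) ^ 2 - C (Real.sinh t : ℂ) ^ 2 =
      (1 : MvPolynomial (Fin 2) ℂ) := by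
    rw [← C_pow, ← C_pow, ← C_sub, cosh_sq_sub_sinh_sq_ofReal, C_1]
  rw [createX_apply, map_sub, map_mul, map_mul, Polynomial.aeval_X, Polynomial.aeval_C,
    Derivation.map_aeval, Derivation.map_aeval]
  simp only [map_sub, Derivation.leibniz, pderiv_X, pderiv_C, smul_eq_mul, Pi.single_apply,
    algebraMap_eq]
  simp only [Complex.ofReal_cosh, Complex.ofReal_sinh] at hc
  simp
  linear_combination (-(C (Real.pi : ℂ)⁻¹ * C (4 : ℂ)⁻¹ *
    Polynomial.aeval (C (Complex.cosh t) * X 0 - C (Complex.sinh t) * X 1)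
      (Polynomial.derivative q))) * hc

lemma createX_pow_one (t : ℝ) (n : ℕ) : (createX t ^ n) 1 =
    Polynomial.aeval (C (Real.cosh t : ℂ) * X 0 - C (Real.sinh t : ℂ) * X 1) (hermitePoly n) := by
  induction n with
  | zero => simp [hermitePoly]
  | succ n ih => rw [pow_succ', Module.End.mul_apply, ih, createX_aeval, hermitePoly]

/-- The first boosted coordinate vanishes on `coneVec t`, so this polynomial is constant along the
line and only the term with `E'` remains. -/
lemma coneOp_one_createX_pow (t : ℝ) (x : Fin 2 → ℝ) (n : ℕ) :
    coneOp 1 t x ((createX t ^ n) 1) =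
      (hermitePoly n).eval (boostX t x : ℂ) *
        (2 * Real.exp (-2 * Real.pi * boostY t x ^ 2) : ℝ) := by
  have e : lineRestrict x (coneVec t) (C (Real.cosh t : ℂ) * X 0 - C (Real.sinh t : ℂ) * X 1) =
      Polynomial.C (boostX t x : ℂ) := by
    rw [map_sub, map_mul, map_mul, lineRestrict_C, lineRestrict_C, lineRestrict_X, lineRestrict_X]
    simp only [coneVec, boostX, if_true, one_ne_zero, if_false, Complex.ofReal_mul,
      Complex.ofReal_sub, Polynomial.C_mul, Polynomial.C_sub]
    ring
  rw [createX_pow_one, coneOp_apply, ← Polynomial.aeval_algHom_apply, e,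
    ← Polynomial.algebraMap_eq, Polynomial.aeval_algebraMap_apply, Polynomial.algebraMap_eq,
    coeffFunctional_C, zero_add, iteratedDeriv_one, deriv_E, Polynomial.coe_aeval_eq_eval]
  simp only [pow_zero, one_mul]
  congr 4
  rw [neg_sq, mul_pow, Real.sq_sqrt (by norm_num)]
  ring

/-- The derivative along the cone of the operator applied to the Hermite polynomials of the
plane. -/
lemma hasDerivAt_coneOp_hermitePlane (i k : ℕ) (t : ℝ) (x : Fin 2 → ℝ) :
    HasDerivAt (fun t => coneOp 0 t x (hermitePlane i k))
      ((2 * √2 * Real.cosh t ^ i * Real.sinh t ^ k : ℝ) *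
        ((hermitePoly (i + k + 1)).eval (boostX t x : ℂ) *
          (Real.exp (-2 * Real.pi * boostY t x ^ 2) : ℝ))) t := by
  refine (hasDerivAt_coneOp 0 t x (hermitePlane i k)).congr_deriv ?_
  have h0 : createX t (hermitePlane i k) =
      (create sgn 0 ^ i) ((create sgn 1 ^ k) (createX t 1)) := by
    have h1 := LinearMap.congr_fun ((createX_comm t 0).pow_right i) ((create sgn 1 ^ k) 1)
    have h2 := LinearMap.congr_fun ((createX_comm t 1).pow_right k) 1
    simp only [Module.End.mul_apply] at h1 h2
    rw [hermitePlane, h1, h2]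
  have h3 : (createX t ^ i) ((create sgn 1 ^ k) (createX t 1)) =
      (create sgn 1 ^ k) ((createX t ^ (i + 1)) 1) := by
    have h1 := LinearMap.congr_fun ((createX_comm t 1).pow_pow i k) (createX t 1)
    simp only [Module.End.mul_apply] at h1
    rw [h1, pow_succ (createX t), Module.End.mul_apply]
  rw [h0, zero_add, coneOp_one_create_pow t x 0 _ (coneOp_one_create_zero t x), h3,
    coneOp_one_create_pow t x 1 _ (coneOp_one_create_one t x), ← Module.End.mul_apply, ← pow_add,
    coneOp_one_createX_pow, show k + (i + 1) = i + k + 1 by ring]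
  push_cast
  ring

end ConeOperators

/-! ### Spherical polynomials as sums of products of plane Hermite polynomials. -/

section PlaneProducts

open MvPolynomial

/-! ### Products of polynomials in the separate planes -/

section Planes

variable {m : ℕ}

/-- The product of polynomials `h j` in the variables of the `j`-th plane. -/
def planeProd (h : Fin m → MvPolynomial (Fin 2) ℂ) : Poly m := ∏ j, rename (Prod.mk j) (h j)

lemma planeProd_eq_mul (h : Fin m → MvPolynomial (Fin 2) ℂ) (j : Fin m) :
    planeProd h = rename (Prod.mk j) (h j) *
      ∏ i ∈ Finset.univ.erase j, rename (Prod.mk i) (h i) :=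
  (Finset.mul_prod_erase _ _ (Finset.mem_univ j)).symm

lemma planeProd_update (h : Fin m → MvPolynomial (Fin 2) ℂ) (j : Fin m)
    (g : MvPolynomial (Fin 2) ℂ) :
    planeProd (Function.update h j g) = rename (Prod.mk j) g *
      ∏ i ∈ Finset.univ.erase j, rename (Prod.mk i) (h i) := by
  rw [planeProd_eq_mul _ j, Function.update_self]
  congr 1
  refine Finset.prod_congr rfl fun i hi => ?_
  rw [Function.update_of_ne (Finset.ne_of_mem_erase hi)]

lemma pderiv_rename_of_ne {j i : Fin m} (hij : j ≠ i) (l : Fin 2) (g : MvPolynomial (Fin 2) ℂ) :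
    pderiv (j, l) (rename (Prod.mk i) g) = 0 := by
  classical
  refine pderiv_eq_zero_of_notMem_vars fun hmem => ?_
  have := vars_rename (Prod.mk i) g hmem
  simp only [Finset.mem_image, Prod.mk.injEq] at this
  obtain ⟨_, _, h, _⟩ := this
  exact hij h.symm

lemma pderiv_prod_erase (h : Fin m → MvPolynomial (Fin 2) ℂ) (j : Fin m) (l : Fin 2) :
    pderiv (j, l) (∏ i ∈ Finset.univ.erase j, rename (Prod.mk i) (h i)) = 0 := by
  refine Finset.prod_induction _ (fun q : Poly m => pderiv (j, l) q = 0) ?_ ?_ ?_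
  · intro p q hp hq
    rw [Derivation.leibniz, hp, hq, smul_zero, smul_zero, add_zero]
  · exact pderiv_one
  · exact fun i hi => pderiv_rename_of_ne (Finset.ne_of_mem_erase hi).symm l _

lemma pderiv_planeProd (h : Fin m → MvPolynomial (Fin 2) ℂ) (j : Fin m) (l : Fin 2) :
    pderiv (j, l) (planeProd h) = planeProd (Function.update h j (pderiv l (h j))) := by
  rw [planeProd_update, planeProd_eq_mul h j, Derivation.leibniz, pderiv_prod_erase, smul_zero,
    zero_add, smul_eq_mul, pderiv_rename (Prod.mk_right_injective j), mul_comm]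

/-- The signs of the form of signature `(m, m)`. -/
def sgnPlanes (p : Fin m × Fin 2) : ℂ := sgn p.2

lemma create_planeProd (h : Fin m → MvPolynomial (Fin 2) ℂ) (p : Fin m × Fin 2) :
    create sgnPlanes p (planeProd h) =
      planeProd (Function.update h p.1 (create sgn p.2 (h p.1))) := by
  obtain ⟨j, l⟩ := p
  rw [create_apply, create_apply, pderiv_planeProd, planeProd_update, planeProd_update,
    planeProd_eq_mul h j, map_sub, map_mul, map_mul, rename_X, rename_C, sgnPlanes]
  ring

/-! ### The Laplace operator -/

/-- The Laplace operator as a linear map. -/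
def laplaceEnd : Module.End ℂ (Poly m) :=
  ∑ j : Fin m, ((pderiv (j, 0)).toLinearMap * (pderiv (j, 0)).toLinearMap
    - (pderiv (j, 1)).toLinearMap * (pderiv (j, 1)).toLinearMap)

lemma laplaceEnd_apply (g : Poly m) : laplaceEnd g = laplace g := by
  simp [laplaceEnd, laplace, LinearMap.sum_apply]

lemma laplaceEnd_pderiv (p : Fin m × Fin 2) (g : Poly m) :
    laplaceEnd (pderiv p g) = pderiv p (laplaceEnd g) := by
  rw [laplaceEnd_apply, laplaceEnd_apply, laplace, laplace, map_sum]
  refine Finset.sum_congr rfl fun j _ => ?_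
  rw [map_sub, pderiv_comm (j, 0) p g, pderiv_comm (j, 0) p, pderiv_comm (j, 1) p g,
    pderiv_comm (j, 1) p]

lemma laplaceEnd_X_mul (p : Fin m × Fin 2) (g : Poly m) :
    laplaceEnd (X p * g) = X p * laplaceEnd g + C (2 * sgnPlanes p) * pderiv p g := by
  classical
  have key : ∀ q : Fin m × Fin 2, pderiv q (pderiv q (X p * g)) =
      X p * pderiv q (pderiv q g) + if q = p then 2 * pderiv p g else 0 := by
    intro q
    simp only [Derivation.leibniz, pderiv_X, smul_eq_mul, map_add, Pi.single_apply]
    by_cases h : q = p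
    · subst h; simp; ring
    · have h' : p ≠ q := fun e => h e.symm
      simp [h, h']
  obtain ⟨j₀, l⟩ := p
  rw [laplaceEnd_apply, laplaceEnd_apply, laplace, laplace, Finset.mul_sum]
  simp only [key]
  rw [Finset.sum_congr rfl (g := fun j => X (j₀, l) * (pderiv (j, 0) (pderiv (j, 0) g)
    - pderiv (j, 1) (pderiv (j, 1) g)) + if j = j₀ then C (2 * sgnPlanes (j₀, l)) *
      pderiv (j₀, l) g else 0), Finset.sum_add_distrib, Finset.sum_ite_eq' Finset.univ j₀]
  · simp
  · intro j _
    by_cases hj : j = j₀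
    · subst hj
      have h2 : (C 2 : Poly m) = 2 := map_ofNat C 2
      fin_cases l <;> simp [sgnPlanes, sgn, h2] <;> ring
    · simp [hj]; ring

/-- The commutator of `Δ` with `X p` is a multiple of `∂_p`, which commutes with `Δ`; hence each of
the `l + 1` factors contributes equally. -/
lemma laplaceEnd_pow_X_mul (p : Fin m × Fin 2) (g : Poly m) (l : ℕ) :
    (laplaceEnd ^ (l + 1)) (X p * g) = X p * (laplaceEnd ^ (l + 1)) g
      + C (2 * (l + 1) * sgnPlanes p) * pderiv p ((laplaceEnd ^ l) g) := by
  induction l with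
  | zero => simp [laplaceEnd_X_mul]
  | succ l ih =>
    have hC : ∀ (a : ℂ) (q : Poly m), laplaceEnd (C a * q) = C a * laplaceEnd q := by
      intro a q; rw [← smul_eq_C_mul, map_smul, smul_eq_C_mul]
    rw [pow_succ' _ (l + 1), Module.End.mul_apply, ih, map_add, laplaceEnd_X_mul, hC,
      laplaceEnd_pderiv, ← Module.End.mul_apply, ← Module.End.mul_apply, ← pow_succ', ← pow_succ']
    simp only [C_mul, C_add, Nat.cast_add, Nat.cast_one, C_1]
    ring

/-- The truncation of `exp(-Δ/8π)`. -/
def heatTrunc (N : ℕ) (g : Poly m) : Poly m :=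
  ∑ l ∈ Finset.range N, C ((-1 / (8 * (Real.pi : ℂ))) ^ l / (l.factorial : ℂ)) *
    (laplaceEnd ^ l) g

/-- Conjugation by `exp(-Δ/8π)` turns multiplication by `X p` into the creation operator. The
commutator uses up one power of `Δ`, so its truncation has length `N` instead of `N + 1`. -/
lemma heatTrunc_X_mul (N : ℕ) (p : Fin m × Fin 2) (g : Poly m) :
    heatTrunc (N + 1) (X p * g) = X p * heatTrunc (N + 1) g
      - C (sgnPlanes p / (4 * (Real.pi : ℂ))) * pderiv p (heatTrunc N g) := by
  have hpi : (Real.pi : ℂ) ≠ 0 := by exact_mod_cast Real.pi_ne_zero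
  rw [heatTrunc, heatTrunc, heatTrunc, Finset.sum_range_succ', Finset.sum_range_succ', map_sum,
    mul_add, Finset.mul_sum, Finset.mul_sum, add_sub_right_comm, ← Finset.sum_sub_distrib]
  congr 1
  · refine Finset.sum_congr rfl fun l _ => ?_
    have e : C ((-1 / (8 * (Real.pi : ℂ))) ^ (l + 1) / ((l + 1).factorial : ℂ)) *
        C (2 * (l + 1) * sgnPlanes p) = -(C (sgnPlanes p / (4 * (Real.pi : ℂ))) *
          C ((-1 / (8 * (Real.pi : ℂ))) ^ l / (l.factorial : ℂ)) : Poly m) := by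
      rw [← C_mul, ← C_mul, ← C_neg]
      congr 1
      have : ((l : ℂ) + 1) ≠ 0 := by exact_mod_cast Nat.succ_ne_zero l
      have h' : (l.factorial : ℂ) ≠ 0 := by exact_mod_cast Nat.factorial_ne_zero l
      rw [Nat.factorial_succ, pow_succ]
      push_cast
      field_simp
      ring
    rw [laplaceEnd_pow_X_mul, mul_add, ← mul_assoc (C _) (C _), e, pderiv_C_mul]
    ring
  · simp

/-- The linear map `exp(-Δ/8π)`, given on monomials by products of Hermite polynomials. -/
def heatMap : Poly m →ₗ[ℂ] Poly m :=
  (basisMonomials (Fin m × Fin 2) ℂ).constr ℂ fun α =>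
    planeProd fun j => hermitePlane (α (j, 0)) (α (j, 1))

lemma heatMap_monomial (α : Fin m × Fin 2 →₀ ℕ) (a : ℂ) :
    heatMap (monomial α a) = a • planeProd fun j => hermitePlane (α (j, 0)) (α (j, 1)) := by
  have h : monomial α a = a • basisMonomials (Fin m × Fin 2) ℂ α := by
    simp [smul_monomial]
  rw [h, map_smul, heatMap, Module.Basis.constr_basis]

lemma hermitePlane_succ_left (i k : ℕ) :
    hermitePlane (i + 1) k = create sgn 0 (hermitePlane i k) := by
  rw [hermitePlane, hermitePlane, pow_succ', Module.End.mul_apply]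

lemma hermitePlane_succ_right (i k : ℕ) :
    hermitePlane i (k + 1) = create sgn 1 (hermitePlane i k) := by
  have h := LinearMap.congr_fun ((create_comm sgn 1 0).pow_right i) ((create sgn 1 ^ k) 1)
  simp only [Module.End.mul_apply] at h
  rw [hermitePlane, hermitePlane, h, pow_succ', Module.End.mul_apply]

lemma heatMap_X_mul (p : Fin m × Fin 2) (g : Poly m) :
    heatMap (X p * g) = create sgnPlanes p (heatMap g) := by
  classical
  induction g using MvPolynomial.induction_on' with
  | add f g hf hg => rw [mul_add, map_add, map_add, hf, hg, map_add]
  | monomial α a =>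
    rw [show X p * monomial α a = monomial (Finsupp.single p 1 + α) a by
      rw [X, monomial_mul, one_mul], heatMap_monomial, heatMap_monomial, map_smul,
      create_planeProd]
    congr 2
    obtain ⟨j₀, l⟩ := p
    ext1 j
    by_cases hj : j = j₀
    · subst hj
      rw [Function.update_self]
      fin_cases l
      · simp [← hermitePlane_succ_left, add_comm]
      · simp [← hermitePlane_succ_right, add_comm]
    · rw [Function.update_of_ne hj]
      have : j₀ ≠ j := fun e => hj e.symm
      simp [this]

/-- Both sides obey the same recursion under multiplication by a variable. That recursion involves
two truncation lengths, so equality is claimed for all large `N`. -/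
lemma heatMap_eq_heatTrunc (g : Poly m) : ∃ N₀, ∀ N, N₀ ≤ N → heatMap g = heatTrunc N g := by
  induction g using MvPolynomial.induction_on with
  | C a =>
    refine ⟨1, fun N hN => ?_⟩
    obtain ⟨N, rfl⟩ := Nat.exists_eq_add_of_le' hN
    have h0 : ∀ l, (laplaceEnd ^ (l + 1)) (C a : Poly m) = 0 := by
      intro l
      rw [pow_succ, Module.End.mul_apply, laplaceEnd_apply, laplace]
      simp
    rw [heatTrunc, Finset.sum_range_succ', ← monomial_zero', heatMap_monomial]
    simp only [monomial_zero', h0]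
    simp [planeProd, hermitePlane, smul_eq_C_mul]
  | add f g hf hg =>
    obtain ⟨N₁, h₁⟩ := hf
    obtain ⟨N₂, h₂⟩ := hg
    refine ⟨max N₁ N₂, fun N hN => ?_⟩
    rw [map_add, h₁ N (le_trans (le_max_left _ _) hN), h₂ N (le_trans (le_max_right _ _) hN),
      heatTrunc, heatTrunc, heatTrunc, ← Finset.sum_add_distrib]
    exact Finset.sum_congr rfl fun l _ => by rw [map_add, mul_add]
  | mul_X g p hg =>
    obtain ⟨N₀, h⟩ := hg
    refine ⟨N₀ + 1, fun N hN => ?_⟩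
    obtain ⟨N, rfl⟩ : ∃ M, N = M + 1 := ⟨N - 1, by omega⟩
    rw [mul_comm, heatMap_X_mul, heatTrunc_X_mul, ← h (N + 1) (by omega), ← h N (by omega),
      create_apply]

/-- Spherical polynomials are fixed by `exp(-Δ/8π)`. -/
lemma heatMap_of_laplace_eq_zero {f : Poly m} (hf : laplace f = 0) : heatMap f = f := by
  obtain ⟨N₀, h⟩ := heatMap_eq_heatTrunc f
  rw [h (N₀ + 1) (by omega), heatTrunc, Finset.sum_range_succ']
  have h0 : ∀ l, (laplaceEnd ^ (l + 1)) f = 0 := by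
    intro l
    rw [pow_succ, Module.End.mul_apply, laplaceEnd_apply, hf, map_zero]
  simp [h0]

/-- The summands need not be spherical; only their sum is fixed by `exp(-Δ/8π)`. -/
lemma eq_sum_planeProd {f : Poly m} (hf : laplace f = 0) :
    f = ∑ α ∈ f.support, coeff α f • planeProd fun j => hermitePlane (α (j, 0)) (α (j, 1)) := by
  conv_lhs => rw [← heatMap_of_laplace_eq_zero hf, f.as_sum, map_sum]
  exact Finset.sum_congr rfl fun α _ => heatMap_monomial _ _

end Planes

end PlaneProducts

/-! ### Factorisation of the kernel and hyperbolic angles of cone points. -/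

section KernelProducts

open MvPolynomial

/-! ### The kernel as a sum of products over the planes -/

section Kernel

variable {m : ℕ}

/-- The vector `c / √(-Q₁(c))`. -/
def unitVec (c : Fin 2 → ℝ) : Fin 2 → ℝ := fun i => c i / √(-Q₁ c)

lemma dirDeriv_planeProd (c : Fin 2 → ℝ) (j : Fin m) (h : Fin m → MvPolynomial (Fin 2) ℂ) :
    dirDeriv c j (planeProd h) =
      planeProd (Function.update h j (planeDeriv (unitVec c) (h j))) := by
  have e : dirDeriv c j (planeProd h) = C (unitVec c 0 : ℂ) * pderiv (j, 0) (planeProd h)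
      + C (unitVec c 1 : ℂ) * pderiv (j, 1) (planeProd h) := by
    simp only [dirDeriv, unitVec, LinearMap.smul_apply, LinearMap.add_apply, smul_add, smul_smul,
      smul_eq_C_mul, Derivation.coeFn_coe]
    congr 3 <;> (push_cast; ring)
  rw [e, pderiv_planeProd, pderiv_planeProd, planeProd_update, planeProd_update, planeProd_update,
    planeDeriv_apply, map_add, map_mul, map_mul, rename_C, rename_C]
  ring

lemma dirDeriv_pow_planeProd (c : Fin 2 → ℝ) (j : Fin m) (k : ℕ)
    (h : Fin m → MvPolynomial (Fin 2) ℂ) :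
    (dirDeriv c j ^ k) (planeProd h) =
      planeProd (Function.update h j ((planeDeriv (unitVec c) ^ k) (h j))) := by
  induction k with
  | zero => simp
  | succ k ih =>
    rw [pow_succ', Module.End.mul_apply, ih, dirDeriv_planeProd, Function.update_self,
      Function.update_idem, pow_succ', Module.End.mul_apply]

lemma list_prod_dirDeriv_planeProd (c : Fin m → Fin 2 → ℝ) (κ : Fin m → ℕ)
    (h : Fin m → MvPolynomial (Fin 2) ℂ) (l : List (Fin m)) (hl : l.Nodup) :
    (l.map fun j => dirDeriv (c j) j ^ κ j).prod (planeProd h) =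
      planeProd fun j => if j ∈ l then (planeDeriv (unitVec (c j)) ^ κ j) (h j) else h j := by
  induction l with
  | nil => simp
  | cons i l ih =>
    rw [List.map_cons, List.prod_cons, Module.End.mul_apply, ih hl.of_cons,
      dirDeriv_pow_planeProd]
    congr 1
    ext1 j
    by_cases hj : j = i
    · subst hj
      simp [(List.nodup_cons.mp hl).1]
    · simp [hj]

lemma eval_planeProd (x : Vec m) (h : Fin m → MvPolynomial (Fin 2) ℂ) :
    eval (fun i => (x i : ℂ)) (planeProd h) = ∏ j, eval (fun i => (x.comp j i : ℂ)) (h j) := by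
  rw [planeProd, map_prod]
  refine Finset.prod_congr rfl fun j _ => ?_
  rw [eval_rename]
  rfl

lemma G_planeProd (h : Fin m → MvPolynomial (Fin 2) ℂ) (c : Fin m → Fin 2 → ℝ) (κ : Fin m → ℕ)
    (x : Vec m) :
    G (planeProd h) c κ x =
      ∏ j, eval (fun i => (x.comp j i : ℂ)) ((planeDeriv (unitVec (c j)) ^ κ j) (h j)) := by
  rw [G, List.ofFn_eq_map, list_prod_dirDeriv_planeProd _ _ _ _ (List.nodup_finRange m),
    eval_planeProd]
  simp

/-- The term of order `k` of the one-plane functional attached to `c`, as it occurs in the kernel. -/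
def planeOp (c : Fin 2 → ℝ) (g : MvPolynomial (Fin 2) ℂ) (x : Fin 2 → ℝ) (k : ℕ) : ℂ :=
  (-1 / (4 * (Real.pi : ℂ))) ^ k *
    ((1 / (k.factorial : ℝ) * iteratedDeriv k E (B₁ c x / √(-Q₁ c)) : ℝ) : ℂ) *
    eval (fun i => (x i : ℂ)) ((planeDeriv (unitVec c) ^ k) g)

lemma planeOp_eq (c : Fin 2 → ℝ) (g : MvPolynomial (Fin 2) ℂ) (x : Fin 2 → ℝ) (k : ℕ) :
    planeOp c g x k = (lineRestrict x (unitVec c) g).coeff k *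
      ((-1 / (4 * (Real.pi : ℂ))) ^ k * ((iteratedDeriv k E (B₁ c x / √(-Q₁ c)) : ℝ) : ℂ)) := by
  have h : (k.factorial : ℂ) ≠ 0 := by exact_mod_cast Nat.factorial_ne_zero k
  rw [planeOp, eval_planeDeriv_pow]
  push_cast
  field_simp

lemma planeOp_eq_zero (c : Fin 2 → ℝ) {g : MvPolynomial (Fin 2) ℂ} (x : Fin 2 → ℝ) {k : ℕ}
    (hk : g.totalDegree < k) : planeOp c g x k = 0 := by
  rw [planeOp_eq, Polynomial.coeff_eq_zero_of_natDegree_lt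
    ((natDegree_lineRestrict_le _ _ _).trans_lt hk), zero_mul]

/-- Sorting the multi-indices `κ` by their sum embeds the box `κ j ≤ e j` into the kernel's index
set. Outside the box some `κ j` exceeds the degree of `h j` and the term vanishes. -/
lemma sum_kernel_planeProd (c : Fin m → Fin 2 → ℝ) {d : ℕ} (h : Fin m → MvPolynomial (Fin 2) ℂ)
    (e : Fin m → ℕ) (he : ∀ j, (h j).totalDegree ≤ e j) (hd : ∑ j, e j ≤ d) (x : Vec m) :
    ∑ k ∈ Finset.range (d + 1), ((-1 : ℂ) ^ k / (4 * (Real.pi : ℂ)) ^ k) *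
      ∑ κ ∈ Finset.piAntidiag (Finset.univ : Finset (Fin m)) k,
        (F c κ x : ℂ) * G (planeProd h) c κ x =
    ∏ j, ∑ k ∈ Finset.range (e j + 1), planeOp (c j) (h j) (x.comp j) k := by
  classical
  have h1 : ∀ k ∈ Finset.range (d + 1), ((-1 : ℂ) ^ k / (4 * (Real.pi : ℂ)) ^ k) *
      ∑ κ ∈ Finset.piAntidiag (Finset.univ : Finset (Fin m)) k,
        (F c κ x : ℂ) * G (planeProd h) c κ x =
      ∑ κ ∈ Finset.piAntidiag (Finset.univ : Finset (Fin m)) k,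
        ∏ j, planeOp (c j) (h j) (x.comp j) (κ j) := by
    intro k _
    rw [Finset.mul_sum]
    refine Finset.sum_congr rfl fun κ hκ => ?_
    have hs : ∑ j, κ j = k := (Finset.mem_piAntidiag.mp hκ).1
    simp only [planeOp, Finset.prod_mul_distrib]
    rw [Finset.prod_pow_eq_pow_sum, hs, ← G_planeProd, F, ← mul_assoc, div_pow,
      Complex.ofReal_prod]
  rw [Finset.sum_congr rfl h1, Finset.sum_sigma', Finset.prod_univ_sum]
  symm
  refine Finset.sum_of_injOn (fun κ => (⟨∑ j, κ j, κ⟩ : Σ _ : ℕ, Fin m → ℕ)) ?_ ?_ ?_ ?_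
  · intro κ _ κ' _ hh
    exact eq_of_heq (Sigma.mk.inj_iff.mp hh).2
  · intro κ hκ
    simp only [Finset.coe_sigma, Set.mem_sigma_iff, Finset.mem_coe, Finset.mem_range,
      Finset.mem_piAntidiag]
    have : ∑ j, κ j ≤ ∑ j, e j := Finset.sum_le_sum fun j _ => by
      have := Finset.mem_range.mp (Fintype.mem_piFinset.mp hκ j)
      omega
    refine ⟨by omega, ?_⟩
    simp
  · rintro ⟨k, κ⟩ hκ hni
    have hs : ∑ j, κ j = k := (Finset.mem_piAntidiag.mp (Finset.mem_sigma.mp hκ).2).1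
    by_cases hall : ∀ j, κ j < e j + 1
    · exact absurd ⟨κ, Fintype.mem_piFinset.mpr fun j => Finset.mem_range.mpr (hall j),
        by simp [hs]⟩ hni
    · push Not at hall
      obtain ⟨j, hj⟩ := hall
      exact Finset.prod_eq_zero (Finset.mem_univ j)
        (planeOp_eq_zero _ _ (lt_of_le_of_lt (he j) hj))
  · intro κ _
    rfl

lemma kernel_planeProd (c₀ c₁ : Fin m → Fin 2 → ℝ) {d : ℕ} (h : Fin m → MvPolynomial (Fin 2) ℂ)
    (e : Fin m → ℕ) (he : ∀ j, (h j).totalDegree ≤ e j) (hd : ∑ j, e j ≤ d) (x : Vec m) :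
    kernel c₀ c₁ d (planeProd h) x =
      ∏ j, (∑ k ∈ Finset.range (e j + 1), planeOp (c₀ j) (h j) (x.comp j) k
        - ∑ k ∈ Finset.range (e j + 1), planeOp (c₁ j) (h j) (x.comp j) k) := by
  rw [kernel]
  simp only [sum_kernel_planeProd _ h e he hd, ← Finset.prod_pow_eq_pow_sum,
    ← Finset.prod_mul_distrib]
  have := Finset.prod_univ_sum (fun _ : Fin m => (Finset.univ : Finset (Fin 2)))
    (fun j s => (-1 : ℂ) ^ (s : ℕ) * ∑ k ∈ Finset.range (e j + 1),
      planeOp (if s = 0 then c₀ j else c₁ j) (h j) (x.comp j) k)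
  rw [Fintype.piFinset_univ] at this
  rw [show (∏ j, (∑ k ∈ Finset.range (e j + 1), planeOp (c₀ j) (h j) (x.comp j) k
        - ∑ k ∈ Finset.range (e j + 1), planeOp (c₁ j) (h j) (x.comp j) k)) = _ from
    Finset.prod_congr rfl fun j _ => ?_, this]
  · rfl
  · rw [Fin.sum_univ_two]
    simp
    ring

lemma kernel_sum_smul (c₀ c₁ : Fin m → Fin 2 → ℝ) (d : ℕ) {ι : Type*} (s : Finset ι) (a : ι → ℂ)
    (g : ι → Poly m) (x : Vec m) :
    kernel c₀ c₁ d (∑ i ∈ s, a i • g i) x = ∑ i ∈ s, a i * kernel c₀ c₁ d (g i) x := by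
  have hG : ∀ c κ, G (∑ i ∈ s, a i • g i) c κ x = ∑ i ∈ s, a i * G (g i) c κ x := by
    intro c κ
    simp only [G, map_sum, map_smul, smul_eval]
  simp only [kernel, hG, Finset.mul_sum]
  symm
  rw [Finset.sum_comm]
  refine Finset.sum_congr rfl fun σ _ => ?_
  rw [Finset.sum_comm]
  refine Finset.sum_congr rfl fun k _ => ?_
  rw [Finset.sum_comm]
  refine Finset.sum_congr rfl fun κ _ => Finset.sum_congr rfl fun i _ => ?_
  ring

/-- A point of the negative cone is a multiple of `coneVec t` for some `t`. -/
lemma exists_unitVec_eq_coneVec {c : Fin 2 → ℝ} (hc : c ∈ negCone) :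
    ∃ t, unitVec c = coneVec t ∧ ∀ x, B₁ c x / √(-Q₁ c) = -(√2 * boostY t x) := by
  obtain ⟨hQ, hpos⟩ := hc
  set r := √(-Q₁ c) with hr
  have hr2 : r ^ 2 = -Q₁ c := Real.sq_sqrt (by linarith)
  have hrpos : 0 < r := Real.sqrt_pos.mpr (by linarith)
  have h2 : √2 ^ 2 = (2 : ℝ) := Real.sq_sqrt (by norm_num)
  have h2pos : 0 < √2 := Real.sqrt_pos.mpr (by norm_num)
  -- The first coordinate of `coneVec t` is `√2 sinh t`, which forces this angle; `c 1 > 0` then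
  -- selects the right sign for `cosh t`.
  refine ⟨Real.arsinh (c 0 / (√2 * r)), ?_⟩
  have hs : Real.sinh (Real.arsinh (c 0 / (√2 * r))) = c 0 / (√2 * r) := Real.sinh_arsinh _
  have hch : Real.cosh (Real.arsinh (c 0 / (√2 * r))) = c 1 / (√2 * r) := by
    rw [Real.cosh_arsinh, Real.sqrt_eq_iff_mul_self_eq_of_pos (by positivity), ← sq, div_pow,
      div_pow, mul_pow, h2, hr2, Q₁]
    have : 2 * -(1 / 2 * (c 0 ^ 2 - c 1 ^ 2)) ≠ 0 := by
      rw [Q₁] at hQ; intro h; linarith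
    rw [show 2 * -(1 / 2 * (c 0 ^ 2 - c 1 ^ 2)) = c 1 ^ 2 - c 0 ^ 2 by ring] at this ⊢
    field_simp
    ring
  generalize Real.arsinh (c 0 / (√2 * r)) = t at hs hch
  constructor
  · ext i
    fin_cases i
    · simp only [unitVec, coneVec, ← hr]
      simp [hs]; field_simp
    · simp only [unitVec, coneVec, ← hr]
      simp [hch]; field_simp
  · intro x
    rw [boostY, hs, hch, B₁]
    field_simp
    ring

lemma sum_planeOp_eq_coneOp {c : Fin 2 → ℝ} {t : ℝ} (h1 : unitVec c = coneVec t)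
    (h2 : ∀ x, B₁ c x / √(-Q₁ c) = -(√2 * boostY t x)) {g : MvPolynomial (Fin 2) ℂ} {e : ℕ}
    (hg : g.totalDegree ≤ e) (x : Fin 2 → ℝ) :
    ∑ k ∈ Finset.range (e + 1), planeOp c g x k = coneOp 0 t x g := by
  rw [coneOp_apply, coeffFunctional_eq_sum _ _
    (Nat.lt_succ_of_le ((natDegree_lineRestrict_le _ _ _).trans hg))]
  refine Finset.sum_congr rfl fun k _ => ?_
  rw [planeOp_eq, h1, h2, add_zero]

lemma totalDegree_pderiv_le {σ : Type*} (i : σ) (g : MvPolynomial σ ℂ) :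
    (pderiv i g).totalDegree ≤ g.totalDegree := by
  classical
  conv_lhs => rw [g.as_sum, map_sum]
  refine totalDegree_finsetSum_le fun s hs => ?_
  rw [pderiv_monomial]
  refine (totalDegree_monomial_le _ _).trans ((Finsupp.degree_mono tsub_le_self).trans ?_)
  exact le_totalDegree hs

lemma totalDegree_create_le (i : Fin 2) (g : MvPolynomial (Fin 2) ℂ) :
    (create sgn i g).totalDegree ≤ g.totalDegree + 1 := by
  rw [create_apply]
  refine (totalDegree_sub _ _).trans (max_le ?_ ?_)
  · refine (totalDegree_mul _ _).trans ?_
    rw [totalDegree_X]; omega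
  · refine (totalDegree_mul _ _).trans ?_
    rw [totalDegree_C]
    have := totalDegree_pderiv_le i g
    omega

lemma totalDegree_hermitePlane_le (i k : ℕ) : (hermitePlane i k).totalDegree ≤ i + k := by
  induction i with
  | zero =>
    induction k with
    | zero => simp [hermitePlane]
    | succ k ih =>
      rw [hermitePlane_succ_right]
      exact (totalDegree_create_le _ _).trans (by omega)
  | succ i ih =>
    rw [hermitePlane_succ_left]
    exact (totalDegree_create_le _ _).trans (by omega)

/-- The kernel of a plane for the monomial `x^i y^k` and the arc from `t₁` to `t₀`. -/
def planeKernel (t₀ t₁ : ℝ) (i k : ℕ) (x : Fin 2 → ℝ) : ℂ :=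
  coneOp 0 t₀ x (hermitePlane i k) - coneOp 0 t₁ x (hermitePlane i k)

lemma IsSpherical.sum_eq_of_mem_support {d : ℕ} {f : Poly m} (hf : IsSpherical d f)
    {α : Fin m × Fin 2 →₀ ℕ} (hα : α ∈ f.support) : ∑ j, (α (j, 0) + α (j, 1)) = d := by
  have h : α.degree = d := by
    by_contra hne
    exact mem_support_iff.mp hα (hf.1.coeff_eq_zero hne)
  rw [← h, Finsupp.degree_eq_sum, Fintype.sum_prod_type]
  simp

lemma kernel_eq_sum_prod {c₀ c₁ : Fin m → Fin 2 → ℝ}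
    (hc₀ : ∀ j, c₀ j ∈ negCone) (hc₁ : ∀ j, c₁ j ∈ negCone) :
    ∃ t₀ t₁ : Fin m → ℝ, ∀ {d : ℕ} {f : Poly m}, IsSpherical d f → ∀ x : Vec m,
      kernel c₀ c₁ d f x = ∑ α ∈ f.support, coeff α f *
        ∏ j, planeKernel (t₀ j) (t₁ j) (α (j, 0)) (α (j, 1)) (x.comp j) := by
  choose t₀ ht₀ using fun j => exists_unitVec_eq_coneVec (hc₀ j)
  choose t₁ ht₁ using fun j => exists_unitVec_eq_coneVec (hc₁ j)
  refine ⟨t₀, t₁, fun {d f} hf x => ?_⟩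
  conv_lhs => rw [eq_sum_planeProd hf.2]
  rw [kernel_sum_smul]
  refine Finset.sum_congr rfl fun α hα => ?_
  congr 1
  rw [kernel_planeProd c₀ c₁ _ (fun j => α (j, 0) + α (j, 1))
    (fun j => totalDegree_hermitePlane_le _ _)]
  · refine Finset.prod_congr rfl fun j _ => ?_
    rw [sum_planeOp_eq_coneOp (ht₀ j).1 (ht₀ j).2 (totalDegree_hermitePlane_le _ _),
      sum_planeOp_eq_coneOp (ht₁ j).1 (ht₁ j).2 (totalDegree_hermitePlane_le _ _), planeKernel]
  -- By homogeneity the plane degrees sum to `d`, so the kernel's cut-off at order `d` loses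
  -- nothing.
  · exact (hf.sum_eq_of_mem_support hα).le

end Kernel

end KernelProducts

/-! ### Gaussian lattice sums and Poisson summation. -/

section Poisson

open MeasureTheory

/-! ### Sums over finite products of index types -/

lemma summable_norm_prod_and_tsum_prod {R κ : Type*} [NormedField R] [CompleteSpace R] {m : ℕ}
    (f : Fin m → κ → R) (hf : ∀ j, Summable fun n => ‖f j n‖) :
    (Summable fun n : Fin m → κ => ‖∏ j, f j (n j)‖) ∧
      ∑' n : Fin m → κ, ∏ j, f j (n j) = ∏ j, ∑' n, f j n := by
  induction m with
  | zero => simp [Summable.of_finite]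
  | succ m ih =>
    obtain ⟨h1, h2⟩ := ih (fun j => f j.succ) fun j => hf j.succ
    have e : ∀ p : κ × (Fin m → κ), ∏ j, f j (Fin.consEquiv (fun _ => κ) p j) =
        f 0 p.1 * ∏ j : Fin m, f j.succ (p.2 j) := by
      intro p
      rw [Fin.prod_univ_succ]
      simp [Fin.consEquiv]
    constructor
    · rw [← (Fin.consEquiv fun _ => κ).summable_iff]
      refine ((hf 0).mul_norm h1).congr fun p => ?_
      rw [Function.comp_apply, e]
    · rw [← (Fin.consEquiv fun _ => κ).tsum_eq, tsum_congr e, Fin.prod_univ_succ, ← h2,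
        tsum_mul_tsum_of_summable_norm (hf 0) h1]

lemma summable_exp_neg_mul_int_sq {ε : ℝ} (hε : 0 < ε) :
    Summable fun n : ℤ => Real.exp (-ε * (n : ℝ) ^ 2) := by
  -- At `z = 0` and `τ = iε/π` the terms of the Jacobi theta series are `e^{-εn²}`.
  have h := ((summable_jacobiTheta₂_term_iff 0 (Complex.I * (ε / Real.pi : ℝ))).mpr (by
    have := Real.pi_pos
    simpa using by positivity)).norm
  refine h.congr fun n => ?_
  rw [jacobiTheta₂_term, Complex.norm_exp]
  congr 1
  have : 2 * (Real.pi : ℂ) * Complex.I * n * 0 +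
      Real.pi * Complex.I * (n : ℂ) ^ 2 * (Complex.I * (ε / Real.pi : ℝ)) =
      ((-ε * (n : ℝ) ^ 2 : ℝ) : ℂ) := by
    have : (Real.pi : ℂ) ≠ 0 := by exact_mod_cast Real.pi_ne_zero
    push_cast
    field_simp
    linear_combination (n : ℂ) ^ 2 * ε * Complex.I_sq
  rw [this, Complex.ofReal_re]

lemma summable_gaussian_lattice {d : ℕ} {ε : ℝ} (hε : 0 < ε) :
    Summable fun n : Fin d → ℤ => Real.exp (-ε * ∑ i, (n i : ℝ) ^ 2) := by
  have h := (summable_norm_prod_and_tsum_prod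
    (fun (_ : Fin d) (n : ℤ) => Real.exp (-ε * (n : ℝ) ^ 2))
    fun _ => (summable_exp_neg_mul_int_sq hε).norm).1
  refine h.congr fun n => ?_
  rw [← Real.exp_sum, Finset.mul_sum, Real.norm_of_nonneg (Real.exp_nonneg _)]

lemma integrable_gaussian_pi {d : ℕ} {ε : ℝ} (hε : 0 < ε) :
    Integrable fun x : Fin d → ℝ => Real.exp (-ε * ∑ i, x i ^ 2) := by
  have h : Integrable (fun x : Fin d → ℝ => ∏ i, Real.exp (-ε * x i ^ 2)) :=
    Integrable.fintype_prod (f := fun _ y => Real.exp (-ε * y ^ 2))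
      fun _ => integrable_exp_neg_mul_sq hε
  refine h.congr (Filter.Eventually.of_forall fun x => ?_)
  simp only
  rw [← Real.exp_sum, Finset.mul_sum]

/-- A Gaussian bound for all lattice translates of points of a bounded set. -/
lemma norm_translate_le {d : ℕ} {F : (Fin d → ℝ) → ℂ} {A ε : ℝ} (hε : 0 < ε)
    (hb : ∀ x, ‖F x‖ ≤ A * Real.exp (-ε * ∑ i, x i ^ 2)) {R : ℝ} {x : Fin d → ℝ}
    (hx : ∀ i, |x i| ≤ R) (n : Fin d → ℤ) :
    ‖F (fun i => x i + n i)‖ ≤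
      A * Real.exp (ε * (d * R ^ 2)) * Real.exp (-(ε / 2) * ∑ i, (n i : ℝ) ^ 2) := by
  have hA : 0 ≤ A := by
    have h := (norm_nonneg _).trans (hb 0)
    by_contra hneg
    push Not at hneg
    have := mul_neg_of_neg_of_pos hneg (Real.exp_pos (-ε * ∑ i, (0 : Fin d → ℝ) i ^ 2))
    linarith
  refine (hb _).trans ?_
  rw [mul_assoc, ← Real.exp_add]
  refine mul_le_mul_of_nonneg_left (Real.exp_le_exp.mpr ?_) hA
  -- `(x + n)² - n²/2 + x² = (2x + n)²/2 ≥ 0`, at the cost of half of the decay rate.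
  have h1 : ∑ i, ((n i : ℝ) ^ 2 / 2 - R ^ 2) ≤ ∑ i, (x i + n i) ^ 2 := by
    refine Finset.sum_le_sum fun i _ => ?_
    have : x i ^ 2 ≤ R ^ 2 := sq_le_sq' (by linarith [abs_le.mp (hx i)]) (abs_le.mp (hx i)).2
    nlinarith [sq_nonneg (2 * x i + n i)]
  rw [Finset.sum_sub_distrib, ← Finset.sum_div, Finset.sum_const, Finset.card_univ,
    Fintype.card_fin, nsmul_eq_mul] at h1
  nlinarith

lemma iUnion_cube (d : ℕ) :
    ⋃ n : Fin d → ℤ, {x : Fin d → ℝ | ∀ i, x i ∈ Set.Ioc (n i : ℝ) (n i + 1)} = Set.univ := by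
  -- The cubes are open on the left, hence `⌈x⌉ - 1` rather than the floor.
  refine Set.eq_univ_of_forall fun x => Set.mem_iUnion.mpr ⟨fun i => ⌈x i⌉ - 1, fun i => ?_⟩
  have h1 := Int.ceil_lt_add_one (x i)
  have h2 := Int.le_ceil (x i)
  constructor <;> push_cast <;> linarith

lemma pairwise_disjoint_cube (d : ℕ) : Pairwise (Function.onFun Disjoint
    fun n : Fin d → ℤ => {x : Fin d → ℝ | ∀ i, x i ∈ Set.Ioc (n i : ℝ) (n i + 1)}) := by
  intro n n' hne
  refine Set.disjoint_left.mpr fun x hx hx' => hne ?_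
  ext i
  obtain ⟨h1, h2⟩ := hx i
  obtain ⟨h3, h4⟩ := hx' i
  have h5 : (n i : ℝ) < n' i + 1 := by linarith
  have h6 : (n' i : ℝ) < n i + 1 := by linarith
  have h7 : n i < n' i + 1 := by exact_mod_cast h5
  have h8 : n' i < n i + 1 := by exact_mod_cast h6
  omega

lemma measurableSet_cube {d : ℕ} (a : Fin d → ℝ) :
    MeasurableSet {x : Fin d → ℝ | ∀ i, x i ∈ Set.Ioc (a i) (a i + 1)} :=
  MeasurableSet.univ_pi' fun _ => measurableSet_Ioc

/-- The integral over `ℝ^d` is the sum of the integrals over the translates of the unit cube. -/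
lemma hasSum_integral_cube {d : ℕ} {F : (Fin d → ℝ) → ℂ} (hF : Integrable F) :
    HasSum (fun n : Fin d → ℤ =>
      ∫ x in {x : Fin d → ℝ | ∀ i, x i ∈ Set.Ioc ((0 : Fin d → ℝ) i) ((0 : Fin d → ℝ) i + 1)},
        F (fun i => x i + n i)) (∫ x, F x) := by
  have h := hasSum_integral_iUnion (μ := volume) (f := F)
    (fun n : Fin d → ℤ => measurableSet_cube fun i => (n i : ℝ)) (pairwise_disjoint_cube d)
    hF.integrableOn
  rw [iUnion_cube, setIntegral_univ] at h
  convert! h using 2 with n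
  have hp := measurePreserving_add_right (volume : Measure (Fin d → ℝ)) fun i => (n i : ℝ)
  rw [← hp.setIntegral_preimage_emb (measurableEmbedding_addRight _) F
    {x : Fin d → ℝ | ∀ i, x i ∈ Set.Ioc (n i : ℝ) (n i + 1)}]
  congr 2
  ext x
  simp only [Set.mem_preimage, Set.mem_ofPred_eq, Set.mem_Ioc, Pi.add_apply, Pi.zero_apply]
  refine forall_congr' fun i => ?_
  constructor <;> rintro ⟨h1, h2⟩ <;> constructor <;> linarith

/-- Poisson summation on `ℤ^d` for continuous functions with Gaussian decay. -/
theorem tsum_eq_tsum_integral_of_gaussian_decay {d : ℕ} {F : (Fin d → ℝ) → ℂ}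
    (hF : Continuous F) {A ε : ℝ} (hε : 0 < ε)
    (hb : ∀ x, ‖F x‖ ≤ A * Real.exp (-ε * ∑ i, x i ^ 2))
    (hs : Summable fun k : Fin d → ℤ =>
      ∫ x : Fin d → ℝ, Complex.exp (-(2 * Real.pi * Complex.I * ∑ i, (k i : ℂ) * x i)) * F x) :
    ∑' n : Fin d → ℤ, F (fun i => n i) = ∑' k : Fin d → ℤ,
      ∫ x : Fin d → ℝ, Complex.exp (-(2 * Real.pi * Complex.I * ∑ i, (k i : ℂ) * x i)) * F x := by
  have hsum : ∀ R : ℝ, Summable fun n : Fin d → ℤ =>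
      A * Real.exp (ε * (d * R ^ 2)) * Real.exp (-(ε / 2) * ∑ i, (n i : ℝ) ^ 2) :=
    fun R => (summable_gaussian_lattice (half_pos hε)).mul_left _
  have hcont : Continuous fun x : Fin d → ℝ => ∑' n : Fin d → ℤ, F (fun i => x i + n i) := by
    rw [continuous_iff_continuousAt]
    intro x₀
    have hon : ContinuousOn (fun x : Fin d → ℝ => ∑' n : Fin d → ℤ, F (fun i => x i + n i))
        (Metric.ball 0 (‖x₀‖ + 1)) := by
      refine continuousOn_tsum (fun n => (hF.comp (by fun_prop)).continuousOn) (hsum (‖x₀‖ + 1))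
        fun n x hx => norm_translate_le hε hb (fun i => ?_) n
      exact (norm_le_pi_norm x i).trans (mem_ball_zero_iff.mp hx).le
    exact hon.continuousAt (Metric.isOpen_ball.mem_nhds (by simp))
  -- The torus is a topological quotient of `ℝ^d`, so the continuous periodisation of `F` descends
  -- to a continuous function on it.
  have hq : IsOpenQuotientMap (Pi.map fun (_ : Fin d) (y : ℝ) => (y : UnitAddCircle)) :=
    IsOpenQuotientMap.piMap fun _ => QuotientAddGroup.isOpenQuotientMap_mk
  let π : C(Fin d → ℝ, UnitAddTorus (Fin d)) := ⟨_, hq.continuous⟩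
  have hqπ : Topology.IsQuotientMap π := hq.isQuotientMap
  let P : C(Fin d → ℝ, ℂ) := ⟨_, hcont⟩
  have hfac : Function.FactorsThrough P π := by
    intro x y hxy
    have hi : ∀ i, ∃ l : ℤ, x i + l = y i := by
      intro i
      have h : (x i : UnitAddCircle) = y i := congrFun hxy i
      obtain ⟨l, hl⟩ := (QuotientAddGroup.eq_iff_sub_mem.mp h.symm)
      exact ⟨l, by simp at hl; linarith⟩
    choose l hl using hi
    change ∑' n : Fin d → ℤ, F (fun i => x i + n i) = ∑' n : Fin d → ℤ, F (fun i => y i + n i)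
    rw [← (Equiv.addRight l).tsum_eq]
    refine tsum_congr fun n => ?_
    congr 1
    ext i
    simp only [Equiv.coe_addRight, Pi.add_apply, Int.cast_add, ← hl i]
    ring
  let G : C(UnitAddTorus (Fin d), ℂ) := hqπ.lift P hfac
  have hG : ∀ x : Fin d → ℝ, G (fun i => (x i : UnitAddCircle)) =
      ∑' n : Fin d → ℤ, F (fun i => x i + n i) := fun x =>
    congrArg (fun g : C(Fin d → ℝ, ℂ) => g x) (hqπ.lift_comp P hfac)
  have hmF : ∀ (k : Fin d → ℤ) (x : Fin d → ℝ),
      UnitAddTorus.mFourier (-k) (fun i => (x i : UnitAddCircle)) =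
        Complex.exp (-(2 * Real.pi * Complex.I * ∑ i, (k i : ℂ) * x i)) := by
    intro k x
    simp only [UnitAddTorus.mFourier, ContinuousMap.coe_mk]
    rw [Finset.mul_sum, ← Finset.sum_neg_distrib, Complex.exp_sum]
    refine Finset.prod_congr rfl fun i _ => ?_
    rw [fourier_coe_apply]
    congr 1
    push_cast [Pi.neg_apply]
    simp
    ring
  have hnorm : ∀ (k : Fin d → ℤ) (x : Fin d → ℝ),
      ‖Complex.exp (-(2 * Real.pi * Complex.I * ∑ i, (k i : ℂ) * x i))‖ = 1 := by
    intro k x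
    rw [Complex.norm_exp, show -(2 * Real.pi * Complex.I * ∑ i, (k i : ℂ) * x i) =
      ((-(2 * Real.pi * ∑ i, (k i : ℝ) * x i) : ℝ) : ℂ) * Complex.I by push_cast; ring]
    simp
  -- Unfolding: the characters are periodic, so summing over lattice translates of the cube turns
  -- the Fourier coefficient into an integral over `ℝ^d`.
  have hcoeff : ∀ k, UnitAddTorus.mFourierCoeff G k =
      ∫ x : Fin d → ℝ, Complex.exp (-(2 * Real.pi * Complex.I * ∑ i, (k i : ℂ) * x i)) * F x := by
    intro k
    have hint : Integrable fun x : Fin d → ℝ =>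
        Complex.exp (-(2 * Real.pi * Complex.I * ∑ i, (k i : ℂ) * x i)) * F x := by
      refine ((integrable_gaussian_pi hε).const_mul A).mono'
        (by fun_prop) (Filter.Eventually.of_forall fun x => ?_)
      rw [norm_mul, hnorm, one_mul]
      exact hb x
    rw [UnitAddTorus.mFourierCoeff_eq_integral _ _ 0, ← (hasSum_integral_cube hint).tsum_eq]
    symm
    have hper : ∀ (x : Fin d → ℝ) (n : Fin d → ℤ),
        Complex.exp (-(2 * Real.pi * Complex.I * ∑ i, (k i : ℂ) * ((x i + n i : ℝ) : ℂ))) =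
          Complex.exp (-(2 * Real.pi * Complex.I * ∑ i, (k i : ℂ) * x i)) := by
      intro x n
      rw [Complex.exp_eq_exp_iff_exists_int]
      refine ⟨-∑ i, k i * n i, ?_⟩
      push_cast
      simp only [mul_add, Finset.sum_add_distrib]
      ring
    refine (hasSum_integral_of_dominated_convergence (fun n _ =>
      A * Real.exp (ε * (d * 1 ^ 2)) * Real.exp (-(ε / 2) * ∑ i, (n i : ℝ) ^ 2))
      (fun n => ?_) (fun n => ?_) ?_ ?_ ?_).tsum_eq
    · refine Continuous.aestronglyMeasurable ?_
      fun_prop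
    · refine (ae_restrict_iff' (measurableSet_cube 0)).mpr
        (Filter.Eventually.of_forall fun x hx => ?_)
      rw [hper, norm_mul, hnorm, one_mul]
      refine norm_translate_le hε hb (fun i => ?_) n
      obtain ⟨h1, h2⟩ := hx i
      rw [Pi.zero_apply] at h1 h2
      exact abs_le.mpr ⟨by linarith, by linarith⟩
    · exact Filter.Eventually.of_forall fun x => hsum 1
    · have hfin : volume {x : Fin d → ℝ | ∀ i, x i ∈
          Set.Ioc ((0 : Fin d → ℝ) i) ((0 : Fin d → ℝ) i + 1)} ≠ ⊤ := by
        refine ne_of_lt (lt_of_le_of_lt (measure_mono (t := Set.Icc 0 1) fun x hx => ?_)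
          isCompact_Icc.measure_lt_top)
        refine ⟨fun i => (hx i).1.le, fun i => ?_⟩
        have := (hx i).2
        simpa using this
      exact integrableOn_const hfin
    · refine (ae_restrict_iff' (measurableSet_cube 0)).mpr
        (Filter.Eventually.of_forall fun x hx => ?_)
      simp only [hper]
      rw [hmF, hG, smul_eq_mul]
      refine HasSum.mul_left _ (Summable.hasSum ?_)
      refine Summable.of_norm_bounded (hsum 1) fun n => ?_
      refine norm_translate_le hε hb (fun i => ?_) n
      obtain ⟨h1, h2⟩ := hx i
      rw [Pi.zero_apply] at h1 h2
      exact abs_le.mpr ⟨by linarith, by linarith⟩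
  -- Summable coefficients make the Fourier series converge pointwise; at the origin all characters
  -- equal `1`.
  have hfinal := UnitAddTorus.hasSum_mFourier_series_apply_of_summable (f := G)
    (by rw [funext hcoeff]; exact hs) (fun _ => ((0 : ℝ) : UnitAddCircle))
  rw [hG fun _ => 0] at hfinal
  simp only [zero_add] at hfinal
  rw [← hfinal.tsum_eq]
  refine tsum_congr fun k => ?_
  rw [hcoeff]
  have h0 := hmF (-k) fun _ => 0
  rw [neg_neg] at h0
  rw [h0]
  simp

end Poisson

section HermiteFourier

open MeasureTheory
open scoped FourierTransform ComplexConjugate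

/-! ### Fourier transforms of Hermite functions -/

lemma exists_norm_eval_le (p : Polynomial ℂ) {δ : ℝ} (hδ : 0 < δ) :
    ∃ A : ℝ, 0 ≤ A ∧ ∀ u : ℝ, ‖p.eval (u : ℂ)‖ ≤ A * Real.exp (δ * u ^ 2) := by
  induction p using Polynomial.induction_on' with
  | add p q hp hq =>
    obtain ⟨A, hA, h1⟩ := hp
    obtain ⟨A', hA', h2⟩ := hq
    refine ⟨A + A', by positivity, fun u => ?_⟩
    rw [Polynomial.eval_add, add_mul]
    exact (norm_add_le _ _).trans (add_le_add (h1 u) (h2 u))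
  | monomial n a =>
    refine ⟨‖a‖ * (1 + n.factorial / δ ^ n), by positivity, fun u => ?_⟩
    rw [Polynomial.eval_monomial, norm_mul, norm_pow, Complex.norm_real, mul_assoc,
      Real.norm_eq_abs]
    refine mul_le_mul_of_nonneg_left ?_ (norm_nonneg _)
    have h1 := Real.pow_div_factorial_le_exp (δ * u ^ 2) (by positivity) n
    have h2 : 1 ≤ Real.exp (δ * u ^ 2) := Real.one_le_exp (by positivity)
    have h3 : |u| ^ n ≤ 1 + (u ^ 2) ^ n := by
      rw [← sq_abs u, ← pow_mul, mul_comm 2 n, pow_mul]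
      nlinarith [sq_nonneg (|u| ^ n - 1), pow_nonneg (abs_nonneg u) n]
    have h4 : (u ^ 2) ^ n ≤ n.factorial / δ ^ n * Real.exp (δ * u ^ 2) := by
      rw [mul_pow] at h1
      rw [div_mul_eq_mul_div, le_div_iff₀ (by positivity)]
      rw [div_le_iff₀ (by positivity)] at h1
      linarith
    linarith

lemma norm_exp_pi_I_mul_sq (τ : ℂ) (u : ℝ) :
    ‖Complex.exp (Real.pi * Complex.I * τ * (u : ℂ) ^ 2)‖ =
      Real.exp (-(Real.pi * τ.im) * u ^ 2) := by
  rw [Complex.norm_exp]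
  congr 1
  rw [show Real.pi * Complex.I * τ * (u : ℂ) ^ 2 =
    ((Real.pi * u ^ 2 : ℝ) : ℂ) * (Complex.I * τ) by push_cast; ring, Complex.re_ofReal_mul]
  simp
  ring

lemma integrable_eval_mul_exp (p : Polynomial ℂ) {τ : ℂ} (hτ : 0 < τ.im) :
    Integrable fun u : ℝ =>
      p.eval (u : ℂ) * Complex.exp (Real.pi * Complex.I * τ * (u : ℂ) ^ 2) := by
  have hpos : 0 < Real.pi * τ.im / 2 := by have := Real.pi_pos; positivity
  obtain ⟨A, hA, h⟩ := exists_norm_eval_le p hpos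
  refine ((integrable_exp_neg_mul_sq hpos).const_mul A).mono' (by fun_prop)
    (Filter.Eventually.of_forall fun u => ?_)
  rw [norm_mul, norm_exp_pi_I_mul_sq]
  refine (mul_le_mul_of_nonneg_right (h u) (Real.exp_nonneg _)).trans_eq ?_
  rw [mul_assoc, ← Real.exp_add]
  congr 2
  ring

/-- The Hermite function `H_n(√v u) e^{πiτu²}`, where `v = Im τ`. -/
def hermiteFun (n : ℕ) (τ : ℂ) (u : ℝ) : ℂ :=
  (hermitePoly n).eval ((√τ.im * u : ℝ) : ℂ) * Complex.exp (Real.pi * Complex.I * τ * (u : ℂ) ^ 2)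

/-- The derivative of `hermiteFun n τ`. -/
def hermiteFunDeriv (n : ℕ) (τ : ℂ) (u : ℝ) : ℂ :=
  ((√τ.im : ℝ) * (Polynomial.derivative (hermitePoly n)).eval ((√τ.im * u : ℝ) : ℂ)
    + 2 * Real.pi * Complex.I * τ * u * (hermitePoly n).eval ((√τ.im * u : ℝ) : ℂ)) *
      Complex.exp (Real.pi * Complex.I * τ * (u : ℂ) ^ 2)

lemma continuous_hermiteFun (n : ℕ) (τ : ℂ) : Continuous (hermiteFun n τ) := by
  unfold hermiteFun
  fun_prop

lemma hasDerivAt_hermiteFun (n : ℕ) (τ : ℂ) (u : ℝ) :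
    HasDerivAt (hermiteFun n τ) (hermiteFunDeriv n τ u) u := by
  have h0 : HasDerivAt (fun u : ℝ => ((√τ.im * u : ℝ) : ℂ)) ((√τ.im * 1 : ℝ) : ℂ) u :=
    ((hasDerivAt_id u).const_mul √τ.im).ofReal_comp
  have h1 := ((hermitePoly n).hasDerivAt ((√τ.im * u : ℝ) : ℂ)).comp u h0
  have h2 : HasDerivAt (fun u : ℝ => Complex.exp (Real.pi * Complex.I * τ * (u : ℂ) ^ 2))
      (Complex.exp (Real.pi * Complex.I * τ * (u : ℂ) ^ 2) *
        (Real.pi * Complex.I * τ * (((2 : ℕ) : ℂ) * (u : ℂ) ^ (2 - 1) * ((1 : ℝ) : ℂ)))) u :=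
    (((hasDerivAt_id u).ofReal_comp.pow 2).const_mul _).cexp
  refine (h1.mul h2).congr_deriv ?_
  rw [hermiteFunDeriv]
  simp only [Function.comp_apply]
  push_cast
  ring

/-- Since `i conj(τ) - iτ = 2v`, the derivative of the Gaussian combines with the first term to give
`√v u`. This form uses only multiplication by `u` and `d/du`, which the Fourier transform
interchanges. -/
lemma hermiteFun_succ (n : ℕ) {τ : ℂ} (hτ : 0 < τ.im) (u : ℝ) :
    hermiteFun (n + 1) τ u = 1 / (2 * (√τ.im : ℝ)) *
      (Complex.I * conj τ * (u * hermiteFun n τ u) - 1 / (2 * Real.pi) * hermiteFunDeriv n τ u) := by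
  have hs : ((√τ.im : ℝ) : ℂ) ≠ 0 := by exact_mod_cast (Real.sqrt_pos.mpr hτ).ne'
  have hpi : (Real.pi : ℂ) ≠ 0 := by exact_mod_cast Real.pi_ne_zero
  have hsq : ((√τ.im : ℝ) : ℂ) ^ 2 = τ.im := by
    rw [← Complex.ofReal_pow, Real.sq_sqrt hτ.le]
  have hcj : Complex.I * conj τ = Complex.I * τ + 2 * (τ.im : ℂ) := by
    apply Complex.ext <;> simp
    ring
  rw [hermiteFun, hermiteFun, hermiteFunDeriv, hermitePoly, hcj, ← hsq]
  simp only [Polynomial.eval_sub, Polynomial.eval_mul, Polynomial.eval_X, Polynomial.eval_C]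
  push_cast
  field_simp
  ring

lemma integrable_hermiteFun (n : ℕ) {τ : ℂ} (hτ : 0 < τ.im) : Integrable (hermiteFun n τ) := by
  refine (integrable_eval_mul_exp ((hermitePoly n).comp
    (Polynomial.C ((√τ.im : ℝ) : ℂ) * Polynomial.X)) hτ).congr
    (Filter.Eventually.of_forall fun u => ?_)
  simp [hermiteFun]

lemma integrable_mul_hermiteFun (n : ℕ) {τ : ℂ} (hτ : 0 < τ.im) :
    Integrable fun u : ℝ => (u : ℂ) * hermiteFun n τ u := by
  refine (integrable_eval_mul_exp (Polynomial.X * (hermitePoly n).comp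
    (Polynomial.C ((√τ.im : ℝ) : ℂ) * Polynomial.X)) hτ).congr
    (Filter.Eventually.of_forall fun u => ?_)
  simp [hermiteFun, mul_assoc]

lemma integrable_hermiteFunDeriv (n : ℕ) {τ : ℂ} (hτ : 0 < τ.im) :
    Integrable (hermiteFunDeriv n τ) := by
  refine (integrable_eval_mul_exp (Polynomial.C ((√τ.im : ℝ) : ℂ) *
    (Polynomial.derivative (hermitePoly n)).comp (Polynomial.C ((√τ.im : ℝ) : ℂ) * Polynomial.X)
      + Polynomial.C (2 * Real.pi * Complex.I * τ) * Polynomial.X *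
        (hermitePoly n).comp (Polynomial.C ((√τ.im : ℝ) : ℂ) * Polynomial.X)) hτ).congr
    (Filter.Eventually.of_forall fun u => ?_)
  simp [hermiteFunDeriv]

lemma neg_one_div_im (τ : ℂ) : (-1 / τ).im = τ.im / ‖τ‖ ^ 2 := by
  rw [neg_div, one_div, Complex.neg_im, Complex.inv_im, Complex.normSq_eq_norm_sq]
  ring

lemma neg_one_div_im_pos {τ : ℂ} (hτ : 0 < τ.im) : 0 < (-1 / τ).im := by
  have hne : τ ≠ 0 := by rintro rfl; simp at hτ
  rw [neg_one_div_im]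
  have := norm_pos_iff.mpr hne
  positivity

lemma sqrt_neg_one_div_im (τ : ℂ) : √(-1 / τ).im = √τ.im / ‖τ‖ := by
  rw [neg_one_div_im, Real.sqrt_div' _ (by positivity), Real.sqrt_sq (norm_nonneg _)]

lemma fourier_linear_comb (α β : ℂ) {f g : ℝ → ℂ} (hf : Integrable f) (hg : Integrable g)
    (ξ : ℝ) : 𝓕 (fun u => α * f u + β * g u) ξ = α * 𝓕 f ξ + β * 𝓕 g ξ := by
  have hi : ∀ {h : ℝ → ℂ}, Integrable h →
      Integrable fun v : ℝ => Complex.exp ((-2 * Real.pi * v * ξ : ℝ) * Complex.I) • h v := by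
    intro h hh
    refine hh.norm.mono' ?_ (Filter.Eventually.of_forall fun v => ?_)
    · have hc : Continuous fun v : ℝ => Complex.exp ((-2 * Real.pi * v * ξ : ℝ) * Complex.I) := by
        fun_prop
      exact hc.aestronglyMeasurable.smul hh.aestronglyMeasurable
    · rw [norm_smul, Complex.norm_exp_ofReal_mul_I, one_mul]
  rw [Real.fourier_real_eq_integral_exp_smul, Real.fourier_real_eq_integral_exp_smul,
    Real.fourier_real_eq_integral_exp_smul, ← integral_const_mul, ← integral_const_mul,
    ← integral_add ((hi hf).const_mul α) ((hi hg).const_mul β)]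
  refine integral_congr_ae (Filter.Eventually.of_forall fun v => ?_)
  simp only [smul_eq_mul]
  ring

/-- The Fourier transform of a Hermite function. -/
theorem fourier_hermiteFun (n : ℕ) {τ : ℂ} (hτ : 0 < τ.im) :
    𝓕 (hermiteFun n τ) = fun ξ => 1 / (-Complex.I * τ) ^ (1 / 2 : ℂ) * (conj τ / ‖τ‖) ^ n *
      hermiteFun n (-1 / τ) ξ := by
  have hne : τ ≠ 0 := by rintro rfl; simp at hτ
  have hcne : conj τ ≠ 0 := by simpa using hne
  have hnorm : ((‖τ‖ : ℝ) : ℂ) ≠ 0 := by exact_mod_cast (norm_pos_iff.mpr hne).ne'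
  have hpi : (Real.pi : ℂ) ≠ 0 := by exact_mod_cast Real.pi_ne_zero
  have hs : ((√τ.im : ℝ) : ℂ) ≠ 0 := by exact_mod_cast (Real.sqrt_pos.mpr hτ).ne'
  induction n with
  | zero =>
    have hb : 0 < (-Complex.I * τ).re := by simpa using hτ
    have h := fourier_gaussian_pi hb
    have e : hermiteFun 0 τ =
        fun x : ℝ => Complex.exp (-Real.pi * (-Complex.I * τ) * (x : ℂ) ^ 2) := by
      ext u
      rw [hermiteFun, hermitePoly, Polynomial.eval_one, one_mul]
      congr 1
      ring
    rw [e, h]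
    ext ξ
    rw [hermiteFun, hermitePoly, Polynomial.eval_one, pow_zero, mul_one, one_mul]
    congr 2
    field_simp
    rw [Complex.I_sq]
    ring
  | succ n ih =>
    ext ξ
    -- The constants are arranged so that the two terms match the Fourier rules for multiplication
    -- by `-2πiu` and for `d/du`. Their images recombine into the recursion at `-1/τ`, with a new
    -- factor `conj(τ)/|τ|`.
    have e : hermiteFun (n + 1) τ = fun u : ℝ => 1 / (2 * (√τ.im : ℝ)) *
        (Complex.I * conj τ * (-1 / (2 * Real.pi * Complex.I))) *
          ((-2 * Real.pi * Complex.I * u) • hermiteFun n τ u)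
        + (-(1 / (2 * (√τ.im : ℝ)) * (1 / (2 * Real.pi)))) * deriv (hermiteFun n τ) u := by
      ext u
      rw [hermiteFun_succ n hτ, (hasDerivAt_hermiteFun n τ u).deriv, smul_eq_mul]
      field_simp
      ring
    have hi2 := integrable_mul_hermiteFun n hτ
    have hd : deriv (hermiteFun n τ) = hermiteFunDeriv n τ :=
      funext fun u => (hasDerivAt_hermiteFun n τ u).deriv
    have hX : 𝓕 (fun u : ℝ => (-2 * Real.pi * Complex.I * u) • hermiteFun n τ u) ξ =
        1 / (-Complex.I * τ) ^ (1 / 2 : ℂ) * (conj τ / ‖τ‖) ^ n * hermiteFunDeriv n (-1 / τ) ξ := by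
      rw [← Real.deriv_fourier (integrable_hermiteFun n hτ) (by simpa using hi2), ih]
      exact ((hasDerivAt_hermiteFun n (-1 / τ) ξ).const_mul _).deriv
    have hD : 𝓕 (deriv (hermiteFun n τ)) ξ = (2 * Real.pi * Complex.I * ξ) *
        (1 / (-Complex.I * τ) ^ (1 / 2 : ℂ) * (conj τ / ‖τ‖) ^ n * hermiteFun n (-1 / τ) ξ) := by
      rw [Real.fourier_deriv (integrable_hermiteFun n hτ)
        (fun u => (hasDerivAt_hermiteFun n τ u).differentiableAt)
        (by rw [hd]; exact integrable_hermiteFunDeriv n hτ), ih]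
      rfl
    have hint1 : Integrable fun u : ℝ => (-2 * Real.pi * Complex.I * u) • hermiteFun n τ u := by
      refine (hi2.const_mul (-2 * Real.pi * Complex.I)).congr
        (Filter.Eventually.of_forall fun u => ?_)
      simp only [smul_eq_mul]; ring
    have hint2 : Integrable (deriv (hermiteFun n τ)) := by
      rw [hd]; exact integrable_hermiteFunDeriv n hτ
    rw [e, fourier_linear_comb _ _ hint1 hint2, hX, hD, hermiteFun_succ n (neg_one_div_im_pos hτ),
      sqrt_neg_one_div_im]
    rw [map_div₀, map_neg, map_one, pow_succ]
    push_cast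
    field_simp
    ring

end HermiteFourier

section Boosts

open MeasureTheory
open scoped FourierTransform ComplexConjugate

/-! ### Boosted Gaussians on the plane -/

/-- The function `e^{-πi conj(τ) u²}`. -/
def conjGauss (τ : ℂ) (u : ℝ) : ℂ := Complex.exp (-(Real.pi * Complex.I * conj τ * (u : ℂ) ^ 2))

/-- The Hermite function in the first and the Gaussian in the second boosted coordinate. -/
def boostFun (n : ℕ) (t : ℝ) (τ : ℂ) (x : Fin 2 → ℝ) : ℂ :=
  hermiteFun n τ (boostX t x) * conjGauss τ (boostY t x)

lemma norm_conjGauss (τ : ℂ) (u : ℝ) :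
    ‖conjGauss τ u‖ = Real.exp (-(Real.pi * τ.im) * u ^ 2) := by
  rw [conjGauss, Complex.norm_exp]
  congr 1
  rw [show -(Real.pi * Complex.I * conj τ * (u : ℂ) ^ 2) =
    ((-(Real.pi * u ^ 2) : ℝ) : ℂ) * (Complex.I * conj τ) by push_cast; ring,
    Complex.re_ofReal_mul]
  simp
  ring

lemma continuous_conjGauss (τ : ℂ) : Continuous (conjGauss τ) := by
  unfold conjGauss
  fun_prop

lemma fourier_conjGauss {τ : ℂ} (hτ : 0 < τ.im) :
    𝓕 (conjGauss τ) = fun ξ => 1 / (Complex.I * conj τ) ^ (1 / 2 : ℂ) * conjGauss (-1 / τ) ξ := by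
  have hne : τ ≠ 0 := by rintro rfl; simp at hτ
  have hcne : conj τ ≠ 0 := by simpa using hne
  have hb : 0 < (Complex.I * conj τ).re := by simpa using hτ
  have h := fourier_gaussian_pi hb
  have e : conjGauss τ =
      fun x : ℝ => Complex.exp (-Real.pi * (Complex.I * conj τ) * (x : ℂ) ^ 2) := by
    ext u
    rw [conjGauss]
    congr 1
    ring
  rw [e, h]
  ext ξ
  rw [conjGauss, map_div₀, map_neg, map_one]
  congr 2
  field_simp
  rw [Complex.I_sq]
  ring

/-- The bases are conjugate and lie in the right half-plane, off the branch cut, so the principal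
roots are conjugate too. -/
lemma cpow_half_mul_cpow_half_conj {τ : ℂ} (hτ : 0 < τ.im) :
    (-Complex.I * τ) ^ (1 / 2 : ℂ) * (Complex.I * conj τ) ^ (1 / 2 : ℂ) = (‖τ‖ : ℂ) := by
  have hne : τ ≠ 0 := by rintro rfl; simp at hτ
  have hz : -Complex.I * τ ≠ 0 := mul_ne_zero (neg_ne_zero.mpr Complex.I_ne_zero) hne
  have hre : 0 < (-Complex.I * τ).re := by simpa using hτ
  have harg : (-Complex.I * τ).arg ≠ Real.pi := by
    intro h
    rw [Complex.arg_eq_pi_iff] at h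
    linarith [h.1]
  have h1 : Complex.I * conj τ = conj (-Complex.I * τ) := by simp
  have h2 : (conj (-Complex.I * τ)) ^ (1 / 2 : ℂ) = conj ((-Complex.I * τ) ^ (1 / 2 : ℂ)) := by
    rw [Complex.conj_cpow _ _ harg, map_div₀, map_one, map_ofNat]
  rw [h1, h2, Complex.mul_conj, Complex.normSq_eq_norm_sq]
  have h3 : ‖(-Complex.I * τ) ^ (1 / 2 : ℂ)‖ = ‖τ‖ ^ (1 / 2 : ℝ) := by
    have := Complex.norm_cpow_real (-Complex.I * τ) (1 / 2 : ℝ)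
    push_cast at this
    rw [this]
    simp
  rw [h3, ← Real.sqrt_eq_rpow, Real.sq_sqrt (norm_nonneg _)]

lemma continuous_boostX (t : ℝ) : Continuous (boostX t) := by
  unfold boostX
  fun_prop

lemma continuous_boostY (t : ℝ) : Continuous (boostY t) := by
  unfold boostY
  fun_prop

lemma continuous_boostFun (n : ℕ) (t : ℝ) (τ : ℂ) : Continuous (boostFun n t τ) :=
  ((continuous_hermiteFun n τ).comp (continuous_boostX t)).mul
    ((continuous_conjGauss τ).comp (continuous_boostY t))

lemma B₁_eq_boost (t : ℝ) (x y : Fin 2 → ℝ) :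
    B₁ x y = boostX t x * boostX t y - boostY t x * boostY t y := by
  have h := Real.cosh_sq_sub_sinh_sq t
  rw [B₁, boostX, boostX, boostY, boostY]
  linear_combination (-(x 0 * y 0) + x 1 * y 1) * h

/-- A boost scales the light-cone coordinates `x 0 ± x 1` by `e^{∓t}`. -/
lemma exp_mul_le_boost {T t : ℝ} (ht : |t| ≤ T) (x : Fin 2 → ℝ) :
    Real.exp (-(2 * T)) * (x 0 ^ 2 + x 1 ^ 2) ≤ boostX t x ^ 2 + boostY t x ^ 2 := by
  obtain ⟨h1, h2⟩ := abs_le.mp ht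
  have e : boostX t x ^ 2 + boostY t x ^ 2 = 1 / 2 * ((x 0 + x 1) ^ 2 * Real.exp (-(2 * t))
      + (x 0 - x 1) ^ 2 * Real.exp (2 * t)) := by
    rw [boostX, boostY, show -(2 * t) = -t + -t by ring, show 2 * t = t + t by ring, Real.exp_add,
      Real.exp_add, Real.cosh_eq, Real.sinh_eq]
    ring
  have h3 : Real.exp (-(2 * T)) ≤ Real.exp (-(2 * t)) := Real.exp_le_exp.mpr (by linarith)
  have h4 : Real.exp (-(2 * T)) ≤ Real.exp (2 * t) := Real.exp_le_exp.mpr (by linarith)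
  rw [e]
  nlinarith [mul_le_mul_of_nonneg_left h3 (sq_nonneg (x 0 + x 1)),
    mul_le_mul_of_nonneg_left h4 (sq_nonneg (x 0 - x 1))]

/-- Gaussian decay of the boosted functions, locally uniformly in the boost. -/
lemma exists_norm_boostFun_le (n : ℕ) {τ : ℂ} (hτ : 0 < τ.im) (T : ℝ) :
    ∃ A ε : ℝ, 0 ≤ A ∧ 0 < ε ∧ ∀ t, |t| ≤ T → ∀ x : Fin 2 → ℝ,
      ‖boostFun n t τ x‖ ≤ A * Real.exp (-ε * ∑ i, x i ^ 2) := by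
  have hπ := Real.pi_pos
  -- Evaluated at `√v u`, the polynomial then grows at most like `e^{πvu²/2}`, half of the exponent
  -- of the Gaussian.
  obtain ⟨A, hA, h⟩ := exists_norm_eval_le (hermitePoly n) (δ := Real.pi / 2) (by positivity)
  refine ⟨A, Real.pi * τ.im / 2 * Real.exp (-(2 * T)), hA, by positivity, fun t ht x => ?_⟩
  rw [boostFun, hermiteFun, norm_mul, norm_mul, norm_exp_pi_I_mul_sq, norm_conjGauss]
  refine (mul_le_mul_of_nonneg_right (mul_le_mul_of_nonneg_right (h _) (Real.exp_nonneg _))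
    (Real.exp_nonneg _)).trans ?_
  rw [mul_assoc, mul_assoc, ← Real.exp_add, ← Real.exp_add]
  refine mul_le_mul_of_nonneg_left (Real.exp_le_exp.mpr ?_) hA
  rw [mul_pow, Real.sq_sqrt hτ.le, Fin.sum_univ_two]
  have h1 := mul_le_mul_of_nonneg_left (exp_mul_le_boost ht x)
    (show 0 ≤ Real.pi * τ.im / 2 by positivity)
  have h2 : 0 ≤ Real.pi * τ.im / 2 * boostY t x ^ 2 := by positivity
  nlinarith

lemma map_boost_volume (t : ℝ) :
    Measure.map (fun x : Fin 2 → ℝ => ![boostX t x, boostY t x]) volume = volume := by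
  have hdet : (!![Real.cosh t, -Real.sinh t; -Real.sinh t, Real.cosh t]).det = 1 := by
    rw [Matrix.det_fin_two_of]
    linarith [Real.cosh_sq_sub_sinh_sq t]
  have h := Real.map_matrix_volume_pi_eq_smul_volume_pi
    (M := !![Real.cosh t, -Real.sinh t; -Real.sinh t, Real.cosh t]) (by rw [hdet]; norm_num)
  rw [hdet] at h
  simp only [inv_one, abs_one, ENNReal.ofReal_one, one_smul] at h
  convert! h using 2
  ext x i
  fin_cases i <;> simp [boostX, boostY, Matrix.toLin'_apply, Matrix.mulVec, Matrix.vecHead,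
    Matrix.vecTail] <;> ring

lemma integral_boost (t : ℝ) (f g : ℝ → ℂ) (hf : Continuous f) (hg : Continuous g) :
    ∫ x : Fin 2 → ℝ, f (boostX t x) * g (boostY t x) = (∫ u, f u) * ∫ u, g u := by
  have h := integral_fintype_prod_volume_eq_prod (ι := Fin 2) (𝕜 := ℂ) (E := fun _ => ℝ) ![f, g]
  simp only [Fin.prod_univ_two, Matrix.cons_val_zero, Matrix.cons_val_one] at h
  have hφ : Continuous fun x : Fin 2 → ℝ => ![boostX t x, boostY t x] := by
    refine continuous_pi fun i => ?_
    fin_cases i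
    · exact continuous_boostX t
    · exact continuous_boostY t
  have hfg : Continuous fun y : Fin 2 → ℝ => f (y 0) * g (y 1) := by fun_prop
  have hm := integral_map (μ := volume) hφ.aemeasurable hfg.aestronglyMeasurable
  rw [map_boost_volume t] at hm
  rw [← h, hm]
  simp

lemma fourier_real_eq_integral_mul (f : ℝ → ℂ) (ξ : ℝ) :
    𝓕 f ξ = ∫ u : ℝ, Complex.exp (-(2 * Real.pi * Complex.I * (u * ξ : ℝ))) * f u := by
  rw [Real.fourier_real_eq_integral_exp_smul]
  refine integral_congr_ae (Filter.Eventually.of_forall fun u => ?_)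
  simp only [smul_eq_mul]
  congr 2
  push_cast
  ring

/-- The Fourier transform of `boostFun` with respect to the form `B₁`. -/
lemma integral_boostFun (n : ℕ) (t : ℝ) {τ : ℂ} (hτ : 0 < τ.im) (ζ : Fin 2 → ℝ) :
    ∫ x : Fin 2 → ℝ, Complex.exp (-(2 * Real.pi * Complex.I * (B₁ x ζ : ℝ))) * boostFun n t τ x =
      1 / ‖τ‖ * (conj τ / ‖τ‖) ^ n * boostFun n t (-1 / τ) ζ := by
  have h1 := congrFun (fourier_hermiteFun n hτ) (boostX t ζ)
  -- The sign comes from the negative direction of `B₁` and disappears because the Gaussian is even.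
  have h2 := congrFun (fourier_conjGauss hτ) (-boostY t ζ)
  rw [fourier_real_eq_integral_mul] at h1 h2
  have hc1 := continuous_hermiteFun n τ
  have hc2 := continuous_conjGauss τ
  have h3 := integral_boost t
    (fun u => Complex.exp (-(2 * Real.pi * Complex.I * (u * boostX t ζ : ℝ))) * hermiteFun n τ u)
    (fun u => Complex.exp (-(2 * Real.pi * Complex.I * (u * -boostY t ζ : ℝ))) * conjGauss τ u)
    (by fun_prop) (by fun_prop)
  rw [h1, h2] at h3
  have e : conjGauss (-1 / τ) (-boostY t ζ) = conjGauss (-1 / τ) (boostY t ζ) := by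
    simp [conjGauss]
  rw [e] at h3
  rw [boostFun, ← cpow_half_mul_cpow_half_conj hτ]
  refine Eq.trans (integral_congr_ae (Filter.Eventually.of_forall fun x => ?_))
    (h3.trans ?_)
  · simp only
    rw [B₁_eq_boost t, boostFun, show -(2 * Real.pi * Complex.I *
      ((boostX t x * boostX t ζ - boostY t x * boostY t ζ : ℝ) : ℂ)) =
      -(2 * Real.pi * Complex.I * (boostX t x * boostX t ζ : ℝ))
        + -(2 * Real.pi * Complex.I * (boostY t x * -boostY t ζ : ℝ)) by push_cast; ring,
      Complex.exp_add]
    ring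
  · rw [cpow_half_mul_cpow_half_conj hτ, ← cpow_half_mul_cpow_half_conj hτ]
    field_simp

end Boosts

section PlaneTheta

open MeasureTheory
open scoped ComplexConjugate

/-! ### Theta series of a plane -/

/-- The character `e^{2πi r}`. -/
def charExp (r : ℝ) : ℂ := Complex.exp (2 * (Real.pi : ℂ) * Complex.I * (r : ℂ))

lemma norm_charExp (r : ℝ) : ‖charExp r‖ = 1 := by
  rw [charExp, show 2 * (Real.pi : ℂ) * Complex.I * (r : ℂ) =
    ((2 * Real.pi * r : ℝ) : ℂ) * Complex.I by push_cast; ring, Complex.norm_exp_ofReal_mul_I]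

lemma continuous_charExp : Continuous charExp := by
  unfold charExp
  fun_prop

lemma continuous_B₁_left (y : Fin 2 → ℝ) : Continuous fun x => B₁ x y := by
  unfold B₁
  fun_prop

/-- Summands of a lattice sum of `boostFun` are bounded uniformly for boosts in a bounded set. -/
lemma exists_summable_bound_boostFun (n : ℕ) {τ : ℂ} (hτ : 0 < τ.im) (T : ℝ) (a : Fin 2 → ℝ) :
    ∃ u : (Fin 2 → ℤ) → ℝ, Summable u ∧ ∀ t, |t| ≤ T → ∀ l : Fin 2 → ℤ,
      ‖boostFun n t τ (fun i => a i + l i)‖ ≤ u l := by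
  obtain ⟨A, ε, -, hε, h⟩ := exists_norm_boostFun_le n hτ T
  exact ⟨_, (summable_gaussian_lattice (half_pos hε)).mul_left _, fun t ht l =>
    norm_translate_le hε (h t ht) (fun i => norm_le_pi_norm a i) l⟩

lemma summable_boostFun_mul_charExp (n : ℕ) {τ : ℂ} (hτ : 0 < τ.im) (t : ℝ) (a b : Fin 2 → ℝ) :
    Summable fun l : Fin 2 → ℤ => boostFun n t τ (fun i => a i + l i) *
      charExp (B₁ (fun i => a i + l i) b) := by
  obtain ⟨u, hu, h⟩ := exists_summable_bound_boostFun n hτ |t| a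
  refine Summable.of_norm_bounded hu fun l => ?_
  rw [norm_mul, norm_charExp, mul_one]
  exact h t le_rfl l

/-- Negation of the second coordinate. -/
def flipSnd : (Fin 2 → ℤ) ≃ (Fin 2 → ℤ) :=
  Function.Involutive.toPerm (fun k => ![k 0, -k 1]) fun k => by ext i; fin_cases i <;> simp

lemma flipSnd_apply (k : Fin 2 → ℤ) : flipSnd k = ![k 0, -k 1] := rfl

/-- The Euclidean pairing with `k` is `B₁` with `flipSnd k`. Together with the character of `b` this
gives the frequency `ζ = -b + flipSnd k`, and the translation by `a` produces the new character. -/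
lemma integral_exp_mul_boostFun (n : ℕ) {τ : ℂ} (hτ : 0 < τ.im) (t : ℝ) (a b : Fin 2 → ℝ)
    (k : Fin 2 → ℤ) :
    ∫ x : Fin 2 → ℝ, Complex.exp (-(2 * Real.pi * Complex.I * ∑ i, (k i : ℂ) * x i)) *
      (boostFun n t (-1 / τ) (fun i => a i + x i) * charExp (B₁ (fun i => a i + x i) b)) =
    (‖τ‖ * (-τ / ‖τ‖) ^ n * charExp (B₁ a b)) *
      (boostFun n t τ (fun i => (-b) i + flipSnd k i) *
        charExp (B₁ (fun i => (-b) i + flipSnd k i) a)) := by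
  have hne : τ ≠ 0 := by rintro rfl; simp at hτ
  have hcne : conj τ ≠ 0 := by simpa using hne
  have hnorm : ((‖τ‖ : ℝ) : ℂ) ≠ 0 := by exact_mod_cast (norm_pos_iff.mpr hne).ne'
  set ζ : Fin 2 → ℝ := fun i => (-b) i + flipSnd k i with hζ
  have hζ0 : ζ 0 = -b 0 + k 0 := by simp [hζ, flipSnd_apply]
  have hζ1 : ζ 1 = -b 1 - k 1 := by simp [hζ, flipSnd_apply, sub_eq_add_neg]
  have e : ∀ x : Fin 2 → ℝ,
      Complex.exp (-(2 * Real.pi * Complex.I * ∑ i, (k i : ℂ) * x i)) *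
      (boostFun n t (-1 / τ) (fun i => a i + x i) * charExp (B₁ (fun i => a i + x i) b)) =
      charExp (B₁ a b) * charExp (B₁ ζ a) *
        (Complex.exp (-(2 * Real.pi * Complex.I * (B₁ (a + x) ζ : ℝ))) *
          boostFun n t (-1 / τ) (a + x)) := by
    intro x
    have h1 : Complex.exp (-(2 * Real.pi * Complex.I * ∑ i, (k i : ℂ) * x i)) *
        charExp (B₁ (a + x) b) = charExp (B₁ a b) * charExp (B₁ ζ a) *
        Complex.exp (-(2 * Real.pi * Complex.I * (B₁ (a + x) ζ : ℝ))) := by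
      simp only [charExp, ← Complex.exp_add]
      congr 1
      simp only [B₁, hζ0, hζ1, Fin.sum_univ_two, Pi.add_apply]
      push_cast
      ring
    have h2 : (fun i => a i + x i) = a + x := rfl
    rw [h2]
    linear_combination boostFun n t (-1 / τ) (a + x) * h1
  simp only [e]
  rw [integral_const_mul, integral_add_left_eq_self (fun x : Fin 2 → ℝ =>
    Complex.exp (-(2 * Real.pi * Complex.I * (B₁ x ζ : ℝ))) * boostFun n t (-1 / τ) x) a,
    integral_boostFun n t (neg_one_div_im_pos hτ)]
  have h3 : -1 / (-1 / τ) = τ := by field_simp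
  have h4 : ((‖-1 / τ‖ : ℝ) : ℂ) = 1 / ‖τ‖ := by
    rw [norm_div, norm_neg, norm_one]; push_cast; rfl
  have h5 : conj (-1 / τ) / (1 / (‖τ‖ : ℂ)) = -τ / ‖τ‖ := by
    have : τ * conj τ = (‖τ‖ : ℂ) ^ 2 := by
      rw [Complex.mul_conj, Complex.normSq_eq_norm_sq]; push_cast; rfl
    rw [map_div₀, map_neg, map_one]
    field_simp
    linear_combination this
  rw [h3, h4, h5]
  field_simp

/-- The transformation of the theta series of a boosted Hermite function. -/
theorem tsum_boostFun_neg_one_div (n : ℕ) {τ : ℂ} (hτ : 0 < τ.im) (t : ℝ) (a b : Fin 2 → ℝ) :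
    ∑' l : Fin 2 → ℤ, boostFun n t (-1 / τ) (fun i => a i + l i) *
        charExp (B₁ (fun i => a i + l i) b) =
      (‖τ‖ * (-τ / ‖τ‖) ^ n * charExp (B₁ a b)) *
        ∑' l : Fin 2 → ℤ, boostFun n t τ (fun i => (-b) i + l i) *
          charExp (B₁ (fun i => (-b) i + l i) a) := by
  obtain ⟨A, ε, hA, hε, h⟩ := exists_norm_boostFun_le n (neg_one_div_im_pos hτ) |t|
  have hcont : Continuous fun x : Fin 2 → ℝ => boostFun n t (-1 / τ) (fun i => a i + x i) *
      charExp (B₁ (fun i => a i + x i) b) := by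
    have h0 : Continuous fun x : Fin 2 → ℝ => fun i => a i + x i := by fun_prop
    exact ((continuous_boostFun n t _).comp h0).mul
      (continuous_charExp.comp ((continuous_B₁_left b).comp h0))
  have hb : ∀ x : Fin 2 → ℝ, ‖boostFun n t (-1 / τ) (fun i => a i + x i) *
      charExp (B₁ (fun i => a i + x i) b)‖ ≤
      A * Real.exp (ε * ∑ i, a i ^ 2) * Real.exp (-(ε / 2) * ∑ i, x i ^ 2) := by
    intro x
    rw [norm_mul, norm_charExp, mul_one, mul_assoc, ← Real.exp_add]
    refine (h t le_rfl _).trans (mul_le_mul_of_nonneg_left (Real.exp_le_exp.mpr ?_) hA)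
    rw [Fin.sum_univ_two, Fin.sum_univ_two, Fin.sum_univ_two]
    nlinarith [mul_nonneg hε.le (sq_nonneg (2 * a 0 + x 0)),
      mul_nonneg hε.le (sq_nonneg (2 * a 1 + x 1))]
  have hsum : Summable fun k : Fin 2 → ℤ =>
      (‖τ‖ * (-τ / ‖τ‖) ^ n * charExp (B₁ a b)) *
        (boostFun n t τ (fun i => (-b) i + flipSnd k i) *
          charExp (B₁ (fun i => (-b) i + flipSnd k i) a)) :=
    (((summable_boostFun_mul_charExp n hτ t (-b) a).comp_injective flipSnd.injective)).mul_left _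
  have hP := tsum_eq_tsum_integral_of_gaussian_decay hcont (half_pos hε) hb
    (by simp only [integral_exp_mul_boostFun n hτ]; exact hsum)
  rw [hP]
  simp only [integral_exp_mul_boostFun n hτ]
  rw [tsum_mul_left, flipSnd.tsum_eq (fun l => boostFun n t τ (fun i => (-b) i + l i) *
    charExp (B₁ (fun i => (-b) i + l i) a))]

/-- The weight function on the cone for the monomial `x^i y^k`. -/
def coneWeight (i k : ℕ) (s : ℝ) : ℂ := (2 * √2 * Real.cosh s ^ i * Real.sinh s ^ k : ℝ)

lemma continuous_coneWeight (i k : ℕ) : Continuous (coneWeight i k) := by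
  unfold coneWeight
  have := Real.continuous_cosh
  have := Real.continuous_sinh
  fun_prop

/-- The summand of the theta series of a plane. -/
def planeTerm (t₀ t₁ : ℝ) (i k : ℕ) (b : Fin 2 → ℝ) (τ : ℂ) (x : Fin 2 → ℝ) : ℂ :=
  planeKernel t₀ t₁ i k (√τ.im • x) *
    Complex.exp (2 * (Real.pi : ℂ) * Complex.I * τ * (Q₁ x : ℂ)) * charExp (B₁ x b)

lemma continuous_boostFun_left (n : ℕ) (τ : ℂ) (x : Fin 2 → ℝ) :
    Continuous fun s => boostFun n s τ x := by
  have h1 : Continuous fun s => boostX s x := by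
    have := Real.continuous_cosh
    have := Real.continuous_sinh
    unfold boostX
    fun_prop
  have h2 : Continuous fun s => boostY s x := by
    have := Real.continuous_cosh
    have := Real.continuous_sinh
    unfold boostY
    fun_prop
  exact ((continuous_hermiteFun n τ).comp h1).mul ((continuous_conjGauss τ).comp h2)

/-- The factor `e^{-2πvY²}` turns the growing `e^{-πiτY²}` into the decaying `e^{-πi conj(τ) Y²}`.
-/
lemma hermite_mul_exp_eq_boostFun (n : ℕ) (s : ℝ) {τ : ℂ} (hτ : 0 < τ.im) (x : Fin 2 → ℝ) :
    (hermitePoly n).eval (boostX s (√τ.im • x) : ℂ) *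
        (Real.exp (-2 * Real.pi * boostY s (√τ.im • x) ^ 2) : ℝ) *
      Complex.exp (2 * (Real.pi : ℂ) * Complex.I * τ * (Q₁ x : ℂ)) = boostFun n s τ x := by
  have hX : boostX s (√τ.im • x) = √τ.im * boostX s x := by simp [boostX]; ring
  have hY : boostY s (√τ.im • x) = √τ.im * boostY s x := by simp [boostY]; ring
  have hQ : Q₁ x = 1 / 2 * (boostX s x ^ 2 - boostY s x ^ 2) := by
    have h := Real.cosh_sq_sub_sinh_sq s
    rw [Q₁, boostX, boostY]
    linear_combination (-(1 / 2) * (x 0 ^ 2 - x 1 ^ 2)) * h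
  have hcj : conj τ = τ - 2 * Complex.I * (τ.im : ℂ) := by
    apply Complex.ext <;> simp
    ring
  rw [hX, hY, boostFun, hermiteFun, conjGauss, mul_pow, Real.sq_sqrt hτ.le, hQ, hcj,
    Complex.ofReal_exp, mul_assoc (Polynomial.eval _ _), mul_assoc (Polynomial.eval _ _),
    ← Complex.exp_add, ← Complex.exp_add]
  congr 2
  push_cast
  linear_combination (-2 * (Real.pi : ℂ) * τ.im * (boostY s x : ℂ) ^ 2) * Complex.I_sq

/-- The fundamental theorem of calculus in the hyperbolic angle. Gaussian bounds uniform over the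
arc then give absolute convergence and the exchange of sum and integral. -/
lemma planeTerm_eq_integral (t₀ t₁ : ℝ) (i k : ℕ) (b : Fin 2 → ℝ) {τ : ℂ} (hτ : 0 < τ.im)
    (x : Fin 2 → ℝ) :
    planeTerm t₀ t₁ i k b τ x = ∫ s in t₁..t₀, coneWeight i k s *
      (boostFun (i + k + 1) s τ x * charExp (B₁ x b)) := by
  have hc : Continuous fun s => coneWeight i k s *
      ((hermitePoly (i + k + 1)).eval (boostX s (√τ.im • x) : ℂ) *
        (Real.exp (-2 * Real.pi * boostY s (√τ.im • x) ^ 2) : ℝ)) := by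
    have h0 := continuous_coneWeight i k
    have := Real.continuous_cosh
    have := Real.continuous_sinh
    unfold boostX boostY
    fun_prop
  have h := intervalIntegral.integral_eq_sub_of_hasDerivAt (a := t₁) (b := t₀)
    (fun s _ => hasDerivAt_coneOp_hermitePlane i k s (√τ.im • x)) (hc.intervalIntegrable _ _)
  rw [planeTerm, planeKernel, ← h, ← intervalIntegral.integral_mul_const,
    ← intervalIntegral.integral_mul_const]
  refine intervalIntegral.integral_congr fun s _ => ?_
  rw [← hermite_mul_exp_eq_boostFun (i + k + 1) s hτ x, coneWeight]
  ring

lemma abs_le_of_mem_uIoc {t₀ t₁ s : ℝ} (hs : s ∈ Set.uIoc t₁ t₀) : |s| ≤ max |t₁| |t₀| := by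
  have h := Set.uIoc_subset_uIcc hs
  exact abs_le_max_abs_abs h.1 h.2 |>.trans (by
    rcases le_total t₁ t₀ with h' | h' <;> simp [h', max_comm])

lemma exists_summable_bound_planeTerm (t₀ t₁ : ℝ) (i k : ℕ) (a b : Fin 2 → ℝ) {τ : ℂ}
    (hτ : 0 < τ.im) : ∃ u : (Fin 2 → ℤ) → ℝ, Summable u ∧
      ∀ s ∈ Set.uIoc t₁ t₀, ∀ l : Fin 2 → ℤ, ‖coneWeight i k s *
        (boostFun (i + k + 1) s τ (fun i => a i + l i) *
          charExp (B₁ (fun i => a i + l i) b))‖ ≤ u l := by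
  obtain ⟨u, hu, h⟩ := exists_summable_bound_boostFun (i + k + 1) hτ (max |t₁| |t₀|) a
  obtain ⟨W, hW⟩ := (isCompact_uIcc (a := t₁) (b := t₀)).exists_bound_of_continuousOn
    (continuous_coneWeight i k).continuousOn
  refine ⟨fun l => W * u l, hu.mul_left W, fun s hs l => ?_⟩
  rw [norm_mul, norm_mul, norm_charExp, mul_one]
  have h1 := hW s (Set.uIoc_subset_uIcc hs)
  exact mul_le_mul h1 (h s (abs_le_of_mem_uIoc hs) l) (norm_nonneg _) ((norm_nonneg _).trans h1)

lemma summable_norm_planeTerm (t₀ t₁ : ℝ) (i k : ℕ) (a b : Fin 2 → ℝ) {τ : ℂ} (hτ : 0 < τ.im) :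
    Summable fun l : Fin 2 → ℤ => ‖planeTerm t₀ t₁ i k b τ (fun i => a i + l i)‖ := by
  obtain ⟨u, hu, h⟩ := exists_summable_bound_planeTerm t₀ t₁ i k a b hτ
  refine Summable.of_nonneg_of_le (fun _ => norm_nonneg _) (fun l => ?_) (hu.mul_right |t₀ - t₁|)
  rw [planeTerm_eq_integral _ _ _ _ _ hτ]
  exact intervalIntegral.norm_integral_le_of_norm_le_const fun s hs => h s hs l

lemma tsum_planeTerm (t₀ t₁ : ℝ) (i k : ℕ) (a b : Fin 2 → ℝ) {τ : ℂ} (hτ : 0 < τ.im) :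
    ∑' l : Fin 2 → ℤ, planeTerm t₀ t₁ i k b τ (fun i => a i + l i) =
      ∫ s in t₁..t₀, coneWeight i k s * ∑' l : Fin 2 → ℤ,
        boostFun (i + k + 1) s τ (fun i => a i + l i) * charExp (B₁ (fun i => a i + l i) b) := by
  obtain ⟨u, hu, h⟩ := exists_summable_bound_planeTerm t₀ t₁ i k a b hτ
  simp only [planeTerm_eq_integral _ _ _ _ _ hτ]
  refine (intervalIntegral.hasSum_integral_of_dominated_convergence (fun l _ => u l)
    (fun l => ?_) (fun l => ?_) ?_ ?_ ?_).tsum_eq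
  · refine Continuous.aestronglyMeasurable ?_
    exact (continuous_coneWeight i k).mul ((continuous_boostFun_left _ _ _).mul continuous_const)
  · exact Filter.Eventually.of_forall fun s hs => h s hs l
  · exact Filter.Eventually.of_forall fun s _ => hu
  · exact intervalIntegrable_const
  · exact Filter.Eventually.of_forall fun s _ =>
      (summable_boostFun_mul_charExp _ hτ s a b).hasSum.mul_left _

/-- The transformation of the theta series of a plane. -/
theorem tsum_planeTerm_neg_one_div (t₀ t₁ : ℝ) (i k : ℕ) (a b : Fin 2 → ℝ) {τ : ℂ}
    (hτ : 0 < τ.im) :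
    ∑' l : Fin 2 → ℤ, planeTerm t₀ t₁ i k b (-1 / τ) (fun i => a i + l i) =
      (‖τ‖ * (-τ / ‖τ‖) ^ (i + k + 1) * charExp (B₁ a b)) *
        ∑' l : Fin 2 → ℤ, planeTerm t₀ t₁ i k a τ (fun i => (-b) i + l i) := by
  rw [tsum_planeTerm _ _ _ _ _ _ (neg_one_div_im_pos hτ), tsum_planeTerm _ _ _ _ _ _ hτ,
    ← intervalIntegral.integral_const_mul]
  refine intervalIntegral.integral_congr fun s _ => ?_
  rw [tsum_boostFun_neg_one_div _ hτ]
  ring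

end PlaneTheta

/-! ### Theta series in several planes -/

section Final

variable {m : ℕ}

lemma Q_eq_sum (x : Vec m) : Q x = ∑ j, Q₁ (x.comp j) := by
  rw [Q, Finset.mul_sum]
  rfl

lemma B_eq_sum (x y : Vec m) : B x y = ∑ j, B₁ (x.comp j) (y.comp j) := rfl

lemma charExp_sum {ι : Type*} (s : Finset ι) (r : ι → ℝ) :
    charExp (∑ j ∈ s, r j) = ∏ j ∈ s, charExp (r j) := by
  simp only [charExp]
  rw [← Complex.exp_sum, Complex.ofReal_sum, Finset.mul_sum]

/-- The summand of the theta series as a sum of products over the planes. -/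
lemma thetaTerm_eq_sum_prod {c₀ c₁ : Fin m → Fin 2 → ℝ}
    (hc₀ : ∀ j, c₀ j ∈ negCone) (hc₁ : ∀ j, c₁ j ∈ negCone) :
    ∃ t₀ t₁ : Fin m → ℝ, ∀ {d : ℕ} {f : Poly m}, IsSpherical d f → ∀ (b : Vec m) (τ : ℂ)
      (x : Vec m), thetaTerm c₀ c₁ d f b τ x = ∑ α ∈ f.support, f.coeff α *
        ∏ j, planeTerm (t₀ j) (t₁ j) (α (j, 0)) (α (j, 1)) (b.comp j) τ (x.comp j) := by
  obtain ⟨t₀, t₁, h⟩ := kernel_eq_sum_prod hc₀ hc₁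
  refine ⟨t₀, t₁, fun {d f} hf b τ x => ?_⟩
  have hQ : Complex.exp (2 * (Real.pi : ℂ) * Complex.I * τ * (Q x : ℂ)) =
      ∏ j, Complex.exp (2 * (Real.pi : ℂ) * Complex.I * τ * (Q₁ (x.comp j) : ℂ)) := by
    rw [← Complex.exp_sum, Q_eq_sum, Complex.ofReal_sum, Finset.mul_sum]
  have hB : Complex.exp (2 * (Real.pi : ℂ) * Complex.I * (B x b : ℂ)) =
      ∏ j, charExp (B₁ (x.comp j) (b.comp j)) := by
    rw [← charExp_sum, ← B_eq_sum, charExp]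
  rw [thetaTerm, h hf, hQ, hB, Finset.sum_mul, Finset.sum_mul]
  refine Finset.sum_congr rfl fun α _ => ?_
  simp only [planeTerm, Finset.prod_mul_distrib]
  rw [mul_assoc (MvPolynomial.coeff α f), mul_assoc (MvPolynomial.coeff α f)]
  rfl

/-- The summand over the lattice, indexed by one lattice vector for each plane. -/
lemma summable_and_tsum_planeTerm_prod (t₀ t₁ : Fin m → ℝ) (α : Fin m × Fin 2 →₀ ℕ) (a b : Vec m)
    {τ : ℂ} (hτ : 0 < τ.im) :
    (Summable fun n : Fin m × Fin 2 → ℤ => ‖∏ j, planeTerm (t₀ j) (t₁ j) (α (j, 0)) (α (j, 1))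
      (b.comp j) τ ((shift a n).comp j)‖) ∧
    ∑' n : Fin m × Fin 2 → ℤ, ∏ j, planeTerm (t₀ j) (t₁ j) (α (j, 0)) (α (j, 1))
      (b.comp j) τ ((shift a n).comp j) =
    ∏ j, ∑' l : Fin 2 → ℤ, planeTerm (t₀ j) (t₁ j) (α (j, 0)) (α (j, 1))
      (b.comp j) τ (fun i => a.comp j i + l i) := by
  obtain ⟨h1, h2⟩ := summable_norm_prod_and_tsum_prod
    (fun (j : Fin m) (l : Fin 2 → ℤ) => planeTerm (t₀ j) (t₁ j) (α (j, 0)) (α (j, 1))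
      (b.comp j) τ (fun i => a.comp j i + l i))
    fun j => summable_norm_planeTerm _ _ _ _ _ _ hτ
  have hcomp : ∀ (n : Fin m × Fin 2 → ℤ) (j : Fin m), (shift a n).comp j =
      fun i => a.comp j i + (Equiv.curry (Fin m) (Fin 2) ℤ n j i : ℝ) := fun _ _ => rfl
  simp only [hcomp]
  constructor
  · exact h1.comp_injective (Equiv.curry (Fin m) (Fin 2) ℤ).injective
  · rw [← h2]
    exact (Equiv.curry (Fin m) (Fin 2) ℤ).tsum_eq (fun n : Fin m → Fin 2 → ℤ =>
      ∏ j, planeTerm (t₀ j) (t₁ j) (α (j, 0)) (α (j, 1))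
        (b.comp j) τ (fun i => a.comp j i + n j i))

lemma rpow_neg_one_div_im (d : ℕ) {τ : ℂ} (hτ : 0 < τ.im) :
    (-1 / τ).im ^ (-(d : ℝ) / 2) = τ.im ^ (-(d : ℝ) / 2) * ‖τ‖ ^ d := by
  have hne : τ ≠ 0 := by rintro rfl; simp at hτ
  have hpos := norm_pos_iff.mpr hne
  rw [neg_one_div_im, Real.div_rpow hτ.le (by positivity), ← Real.rpow_natCast ‖τ‖ 2,
    ← Real.rpow_mul hpos.le, div_eq_mul_inv, ← Real.rpow_neg hpos.le, ← Real.rpow_natCast ‖τ‖ d]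
  congr 2
  push_cast
  ring

/-- Each plane raises the Hermite order by one, which accounts for the `m` in the weight `m + d`. -/
lemma norm_pow_mul_prod_phase (d : ℕ) {τ : ℂ} (hτ : 0 < τ.im) (e : Fin m → ℕ)
    (he : ∑ j, e j = d) :
    (‖τ‖ : ℂ) ^ d * ∏ j : Fin m, (‖τ‖ * (-τ / ‖τ‖) ^ (e j + 1)) = (-τ) ^ (m + d) := by
  have hne : τ ≠ 0 := by rintro rfl; simp at hτ
  have hnorm : ((‖τ‖ : ℝ) : ℂ) ≠ 0 := by exact_mod_cast (norm_pos_iff.mpr hne).ne'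
  rw [Finset.prod_mul_distrib, Finset.prod_const, Finset.card_univ, Fintype.card_fin,
    Finset.prod_pow_eq_pow_sum, Finset.sum_add_distrib, he, Finset.sum_const, Finset.card_univ,
    Fintype.card_fin, smul_eq_mul, mul_one, ← mul_assoc, ← pow_add, ← mul_pow,
    mul_div_cancel₀ _ hnorm, add_comm]

lemma neg_comp (b : Vec m) (j : Fin m) : (-b).comp j = -(b.comp j) := rfl

end Final

end IndefiniteTheta

end

theorem theorem5p5 {m d : ℕ} (c₀ c₁ : Fin m → Fin 2 → ℝ)
    (hc₀ : ∀ j, c₀ j ∈ IndefiniteTheta.negCone) (hc₁ : ∀ j, c₁ j ∈ IndefiniteTheta.negCone)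
    (f : IndefiniteTheta.Poly m) (hf : IndefiniteTheta.IsSpherical d f)
    (a b : IndefiniteTheta.Vec m) :
    (∀ τ : ℂ, 0 < τ.im → Summable fun n : Fin m × Fin 2 → ℤ =>
      ‖IndefiniteTheta.thetaTerm c₀ c₁ d f b τ (IndefiniteTheta.shift a n)‖) ∧
    (∀ τ : ℂ, 0 < τ.im →
      IndefiniteTheta.theta c₀ c₁ d f a b (-1 / τ) =
        (-τ) ^ (m + d) *
          Complex.exp (2 * (Real.pi : ℂ) * Complex.I * (IndefiniteTheta.B a b : ℂ)) *
          IndefiniteTheta.theta c₀ c₁ d f (-b) a τ) := by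
  open IndefiniteTheta in
  obtain ⟨t₀, t₁, ht⟩ := thetaTerm_eq_sum_prod hc₀ hc₁
  have key : ∀ (a b : Vec m) {τ : ℂ}, 0 < τ.im →
      ∑' n, thetaTerm c₀ c₁ d f b τ (shift a n) = ∑ α ∈ f.support, f.coeff α *
        ∏ j, ∑' l : Fin 2 → ℤ, planeTerm (t₀ j) (t₁ j) (α (j, 0)) (α (j, 1))
          (b.comp j) τ (fun i => a.comp j i + l i) := by
    intro a b τ hτ
    simp only [ht hf]
    rw [Summable.tsum_finsetSum fun α _ =>
      ((summable_and_tsum_planeTerm_prod t₀ t₁ α a b hτ).1.of_norm.mul_left _)]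
    refine Finset.sum_congr rfl fun α _ => ?_
    rw [tsum_mul_left, (summable_and_tsum_planeTerm_prod t₀ t₁ α a b hτ).2]
  constructor
  · intro τ hτ
    simp only [ht hf]
    refine Summable.of_nonneg_of_le (fun _ => norm_nonneg _) (fun n => norm_sum_le _ _)
      (summable_sum fun α _ => ?_)
    simp only [norm_mul (MvPolynomial.coeff α f)]
    exact (summable_and_tsum_planeTerm_prod t₀ t₁ α a b hτ).1.mul_left _
  · intro τ hτ
    have hB : Complex.exp (2 * (Real.pi : ℂ) * Complex.I * (B a b : ℂ)) =
        ∏ j, charExp (B₁ (a.comp j) (b.comp j)) := by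
      rw [← charExp_sum, ← B_eq_sum, charExp]
    rw [theta, theta, key a b (neg_one_div_im_pos hτ), key (-b) a hτ, rpow_neg_one_div_im d hτ, hB,
      Finset.mul_sum, Finset.mul_sum, Finset.mul_sum]
    refine Finset.sum_congr rfl fun α hα => ?_
    simp only [tsum_planeTerm_neg_one_div _ _ _ _ _ _ hτ, Finset.prod_mul_distrib, neg_comp]
    -- Homogeneity makes the automorphy factor independent of the monomial `α`.
    have hphase := norm_pow_mul_prod_phase d hτ _ (hf.sum_eq_of_mem_support hα)
    rw [Finset.prod_mul_distrib] at hphase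
    rw [← hphase]
    push_cast
    ring
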